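/- **Theorem 4.6 (Combinatorial formula).** Let $a=(a_i)_{i\in\mathbb Z}$ be any sequence of complex numbers and put $(\tau^r a)_i=a_{i+r}$. *Schur functions.* Let $\Lambda=\mathbb C[\mathbf p_1,\mathbf p_2,\dots]$ and $H(u)=1+\sum_{k\ge1}h_ku^{-k}=\exp\big(\sum_{k\ge1}\mathbf p_k u^{-k}/k\big)$. Define $h_{k;a}\in\Lambda$ by $h_{0;a}=1$, $h_{k;a}=0$ for $k<0$, and $$1+\sum_{k\ge1}\frac{h_{k;a}}{(u-a_1)\cdots(u-a_k)}=H(u),$$ and, for a Young diagram $\mu$, put $s_{\mu;a}=\det[h_{\mu_i-i+j;\,\tau^{1-j}a}]_{1\le i,j\le N}$, where $N$ is any integer $\ge\ell(\mu)$. For $f\in\Lambda$ let $f(x;y)$ denote its image under $\mathbf p_k\mapsto\sum_i x_i^k+(-1)^{k-1}\sum_i y_i^k$, where the variables are either $x_1,x_2,\dots,y_1,y_2,\dots$ or $x_1,\dots,x_n,y_1,\dots,y_n$. For Young diagrams $\mu\subseteq\lambda$ let $h_k(x_1,\dots,x_n;y_1,\dots,y_n\mid a)$ be given by $1+\sum_{k\ge1}\frac{h_k(x;y\mid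 a)}{(u-a_1)\cdots(u-a_k)}=\prod_{i=1}^n\frac{u+y_i}{u-x_i}$, $h_0=1$, $h_k=0$ for $k<0$, and put $$s_{\lambda/\mu}(x_1,\dots,x_n;y_1,\dots,y_n\mid a)=\det\big[h_{\lambda_i-\mu_j+j-i}(x;y\mid\tau^{\mu_j-j+1}a)\big]_{1\le i,j\le N},\qquad N\ge\ell(\lambda).$$ *Tableaux.* The square $\square=(i,j)$ (row $i$, column $j$) occupies $[i-1,i]\times[j-1,j]$ and has content $c(\square)=j-i$. Let $\nu$ be a skew diagram without $2\times2$ blocks. If $\nu$ is connected and nonempty, put $$f_{\nu;a}(u,v)=(u+v)\prod_{\text{vertical }(\varepsilon,\delta)}(u-a_{\delta-\varepsilon+1/2})\prod_{\text{horizontal }(\varepsilon,\delta)}(v+a_{\delta-\varepsilon+1/2}),$$ the products being over the midpoints $(\varepsilon,\delta)$ of the vertical, respectively horizontal, sides which are common to two squares of $\nu$; in general $f_{\nu;a}$ is the product over the connected components of $\nu$ (so $f_{\varnothing;a}=1$). A *diagonal-strict tableau* of a (skew) shape is a filling $\mathbb T$ by $1,2,\dots$ which weakly increases along rows and down columns and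 strictly increases along the diagonals $j-i=\mathrm{const}$. An *$\mathbb A$-tableau* is a filling $T$ by letters of $\mathbb A=\{1'<1<2'<2<\cdots\}$ which weakly increases along rows and down columns, with, for each $i$, at most one $i'$ in each row and at most one $i$ in each column. Put $|i'|=|i|=i$, and let the weight of $T$ be $$w_a(T)=\prod_{\square:\,T(\square)\text{ unprimed}}(x_{T(\square)}-a_{c(\square)})\prod_{\square:\,T(\square)\text{ primed}}(y_{|T(\square)|}+a_{c(\square)}).$$ *Claim.* 1. For every Young diagram $\mu$, as formal power series in $x_1,x_2,\dots,y_1,y_2,\dots$, $$s_{\mu;a}(x;y)=\sum_{\mathbb T}\ \prod_{i\ge1}f_{\mathbb T^{-1}(i);a}(x_i,y_i)=\sum_{\mathbb T}\ \sum_{T:\,|T|=\mathbb T}w_a(T),$$ where $\mathbb T$ ranges over the diagonal-strict tableaux of shape $\mu$ and, in the last expression, $T$ ranges over the finitely many $\mathbb A$-tableaux which become $\mathbb T$ when the primes are erased; in both sums over $\mathbb T$ each monomial occurs in only finitely many terms. 2. For every Young diagram $\mu$ and every $n\ge0$, $$s_{\mu;a}(x_1,\dots,x_n;y_1,\dots,y_n)=\sum_{\mathbb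 T}\ \prod_{i=1}^n f_{\mathbb T^{-1}(i);a}(x_i,y_i)=\sum_T w_a(T),$$ summed over the diagonal-strict tableaux $\mathbb T$ of shape $\mu$ with entries in $\{1,\dots,n\}$, respectively over the $\mathbb A$-tableaux $T$ of shape $\mu$ with entries in $\{1'<1<\dots<n'<n\}$. 3. (Skew version.) For all Young diagrams $\mu\subseteq\lambda$ and every $n\ge0$, the polynomial $s_{\lambda/\mu}(x_1,\dots,x_n;y_1,\dots,y_n\mid a)$ equals both the sum of $\prod_{i=1}^n f_{\mathbb T^{-1}(i);a}(x_i,y_i)$ over the diagonal-strict tableaux $\mathbb T$ of shape $\lambda/\mu$ with entries in $\{1,\dots,n\}$ and the sum of $w_a(T)$ over the $\mathbb A$-tableaux $T$ of shape $\lambda/\mu$ with entries in $\{1'<1<\dots<n'<n\}$. -/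

import Mathlib

namespace MultiSchur

/-! ## The algebra of symmetric functions and the series `H(u)`

Formal series in `1/u` are written as power series in `X = 1/u`. -/

/-- The algebra `Λ = ℂ[p₁, p₂, …]`; the variable with index `k` is the generator `p_k`. -/
abbrev SymmFun : Type := MvPolynomial ℕ+ ℂ

/-- The series `∑_{k ≥ 1} p_k X^k / k`. -/
noncomputable def powerSumSeries : PowerSeries SymmFun :=
  PowerSeries.mk fun m =>
    if h : 0 < m then MvPolynomial.C ((m : ℂ)⁻¹) * MvPolynomial.X (⟨m, h⟩ : ℕ+) else 0

/-- `H = 1 + ∑_{k ≥ 1} h_k X^k = exp (∑_{k ≥ 1} p_k X^k / k)`. -/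
noncomputable def completeSeries : PowerSeries SymmFun :=
  (PowerSeries.exp SymmFun).subst powerSumSeries

/-! ## Multiparameter complete functions -/

/-- The expansion of `1 / ((u - a₁) ⋯ (u - a_k))` in powers of `X = 1/u`, namely
`X^k / ((1 - a₁ X) ⋯ (1 - a_k X))`. -/
noncomputable def invFactorial (a : ℤ → ℂ) (k : ℕ) : PowerSeries ℂ :=
  PowerSeries.X ^ k *
    (∏ i ∈ Finset.Icc 1 k, (1 - PowerSeries.C (a (i : ℤ)) * PowerSeries.X))⁻¹

/-- The coefficients `h_{k;a}` of a series `H` in the expansion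
`H = ∑_{k ≥ 0} h_{k;a} / ((u - a₁) ⋯ (u - a_k))`. As `1 / ((u - a₁) ⋯ (u - a_k))` is `X^k` plus
higher powers of `X`, they are determined one after another;
`coeff_eq_sum_hNat` and `eq_hNat` say that they are the unique solution. -/
noncomputable def hNat {R : Type*} [CommRing R] [Algebra ℂ R]
    (H : PowerSeries R) (a : ℤ → ℂ) (k : ℕ) : R :=
  PowerSeries.coeff k H -
    ∑ j : Fin k, algebraMap ℂ R (PowerSeries.coeff k (invFactorial a j)) * hNat H a j
termination_by k
decreasing_by exact j.2

theorem coeff_invFactorial_self (a : ℤ → ℂ) (k : ℕ) :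
    PowerSeries.coeff k (invFactorial a k) = 1 := by
  have h := PowerSeries.coeff_X_pow_mul
    ((∏ i ∈ Finset.Icc 1 k, (1 - PowerSeries.C (a (i : ℤ)) * PowerSeries.X))⁻¹) k 0
  rw [zero_add] at h
  rw [invFactorial, h, PowerSeries.coeff_zero_eq_constantCoeff_apply,
    PowerSeries.constantCoeff_inv, map_prod]
  simp

/-- The coefficient of `X^n` in `H = ∑_k h_{k;a} / ((u - a₁) ⋯ (u - a_k))`; the terms with
`k > n` are divisible by `X^(n+1)`. -/
theorem coeff_eq_sum_hNat {R : Type*} [CommRing R] [Algebra ℂ R]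
    (H : PowerSeries R) (a : ℤ → ℂ) (n : ℕ) :
    PowerSeries.coeff n H = ∑ k ∈ Finset.range (n + 1),
      algebraMap ℂ R (PowerSeries.coeff n (invFactorial a k)) * hNat H a k := by
  rw [Finset.sum_range_succ, coeff_invFactorial_self, map_one, one_mul]
  conv_rhs => rw [hNat]
  rw [Finset.sum_range]
  ring

theorem eq_hNat {R : Type*} [CommRing R] [Algebra ℂ R]
    (H : PowerSeries R) (a : ℤ → ℂ) (g : ℕ → R)
    (hg : ∀ n, PowerSeries.coeff n H = ∑ k ∈ Finset.range (n + 1),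
      algebraMap ℂ R (PowerSeries.coeff n (invFactorial a k)) * g k) :
    g = hNat H a := by
  funext n
  induction n using Nat.strong_induction_on with
  | _ n ih =>
    have h := hg n
    rw [Finset.sum_range_succ, coeff_invFactorial_self, map_one, one_mul, Finset.sum_range] at h
    rw [hNat, h]
    have e : ∀ j : Fin n, hNat H a j = g j := fun j => (ih j j.2).symm
    simp only [e]
    ring

/-- `h_{k;a}` for `k ∈ ℤ`, equal to `0` for negative `k`. -/
noncomputable def hInt {R : Type*} [CommRing R] [Algebra ℂ R]
    (H : PowerSeries R) (a : ℤ → ℂ) (k : ℤ) : R :=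
  if 0 ≤ k then hNat H a k.toNat else 0

/-- The shift `(τ^r a)_i = a_{i+r}`. -/
def shift (r : ℤ) (a : ℤ → ℂ) : ℤ → ℂ := fun i => a (i + r)

/-! ## Multiparameter Schur functions

Rows and columns are numbered from `0`, so `τ^{μ_j - j + 1}` (rows numbered from `1`) reads
`τ^{μ_j - j}`. The number of rows of `mu` is `mu.colLen 0`. -/

/-- The multiparameter Schur function `s_{μ;a} = det [h_{μ_i - i + j; τ^{1-j} a}] ∈ Λ`, the
determinant being taken of order `N`. -/
noncomputable def schur (a : ℤ → ℂ) (mu : YoungDiagram) (N : ℕ) : SymmFun :=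
  Matrix.det (Matrix.of fun i j : Fin N =>
    hInt completeSeries (shift (-(j : ℤ)) a) ((mu.rowLen i : ℤ) - i + j))

/-- The generating series `∏_{i} (u + y_i) / (u - x_i)` over the ring of polynomials in
`x_1, …, x_n, y_1, …, y_n`; here `x_i` is the variable `Sum.inl i`, and `y_i` is `Sum.inr i`. -/
noncomputable def completeSeriesFin (n : ℕ) :
    PowerSeries (MvPolynomial (Fin n ⊕ Fin n) ℂ) :=
  ∏ i : Fin n,
    (1 + PowerSeries.C (MvPolynomial.X (Sum.inr i)) * PowerSeries.X) *
      PowerSeries.invOfUnit (1 - PowerSeries.C (MvPolynomial.X (Sum.inl i)) * PowerSeries.X) 1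

/-- The skew polynomial
`s_{λ/μ}(x_1,…,x_n; y_1,…,y_n | a) = det [h_{λ_i - μ_j + j - i}(x; y | τ^{μ_j - j + 1} a)]`, the
determinant being taken of order `N`. -/
noncomputable def skewSchurFin (a : ℤ → ℂ) (la mu : YoungDiagram) (n N : ℕ) :
    MvPolynomial (Fin n ⊕ Fin n) ℂ :=
  Matrix.det (Matrix.of fun i j : Fin N =>
    hInt (completeSeriesFin n) (shift ((mu.rowLen j : ℤ) - j) a)
      ((la.rowLen i : ℤ) - mu.rowLen j + j - i))

/-! ## The super realization -/

/-- `g` is the sum of the family `f` of formal power series: each monomial occurs in finitely many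
members of the family, and its coefficients add up to its coefficient in `g`. -/
def IsFormalSum {ι σ : Type*} (f : ι → MvPowerSeries σ ℂ) (g : MvPowerSeries σ ℂ) : Prop :=
  ∀ m : σ →₀ ℕ, (Function.support fun i => MvPowerSeries.coeff m (f i)).Finite ∧
    MvPowerSeries.coeff m g = ∑ᶠ i, MvPowerSeries.coeff m (f i)

/-- `f ↦ f(x_1,…,x_n; y_1,…,y_n)`, given by `p_k ↦ ∑ x_i^k + (-1)^(k-1) ∑ y_i^k`. -/
noncomputable def superFin (n : ℕ) : SymmFun →ₐ[ℂ] MvPolynomial (Fin n ⊕ Fin n) ℂ :=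
  MvPolynomial.aeval fun k : ℕ+ =>
    ∑ i, MvPolynomial.X (Sum.inl i) ^ (k : ℕ) +
      (-1) ^ ((k : ℕ) - 1) * ∑ i, MvPolynomial.X (Sum.inr i) ^ (k : ℕ)

/-- The super power sum `∑_i x_i^k + (-1)^(k-1) ∑_i y_i^k` in infinitely many variables
`x_i = Sum.inl i`, `y_i = Sum.inr i`, as a formal power series. -/
noncomputable def superPowerSum (k : ℕ+) : MvPowerSeries (ℕ ⊕ ℕ) ℂ := fun m =>
  ∑ᶠ i : ℕ,
    MvPowerSeries.coeff m ((MvPowerSeries.X (Sum.inl i) : MvPowerSeries (ℕ ⊕ ℕ) ℂ) ^ (k : ℕ) +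
      (-1) ^ ((k : ℕ) - 1) * MvPowerSeries.X (Sum.inr i) ^ (k : ℕ))

/-- `f ↦ f(x; y)` in infinitely many variables. -/
noncomputable def superInf : SymmFun →ₐ[ℂ] MvPowerSeries (ℕ ⊕ ℕ) ℂ :=
  MvPolynomial.aeval superPowerSum

/-! ## Hook weights

A square is a pair `(i, j)` (row, column), numbered from `0`; it occupies `[i, i+1] × [j, j+1]`,
and its content is `j - i`. -/

/-- The content of a square. -/
def content (s : ℕ × ℕ) : ℤ := (s.2 : ℤ) - (s.1 : ℤ)

/-- Two squares share a side. -/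
def Adj (s t : ℕ × ℕ) : Prop :=
  (s.1 = t.1 ∧ (s.2 + 1 = t.2 ∨ t.2 + 1 = s.2)) ∨ (s.2 = t.2 ∧ (s.1 + 1 = t.1 ∨ t.1 + 1 = s.1))

open Classical in
/-- The connected component of the square `s` in the set `nu`. -/
noncomputable def component (nu : Finset (ℕ × ℕ)) (s : ℕ × ℕ) : Finset (ℕ × ℕ) :=
  nu.filter fun t => Relation.ReflTransGen (fun p q => p ∈ nu ∧ q ∈ nu ∧ Adj p q) s t

/-- The set of connected components of `nu`. -/
noncomputable def components (nu : Finset (ℕ × ℕ)) : Finset (Finset (ℕ × ℕ)) :=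
  nu.image (component nu)

/-- The weight of a skew hook `nu`: `u + v` times a factor `u - a'_{δ-ε}` for each vertical
interior side and a factor `v + a'_{δ-ε}` for each horizontal one, `(ε, δ)` being the midpoint of
the side, where `a'_e = a_{e + 1/2}`. The vertical side between `(i, j)` and `(i, j+1)` has
midpoint `(i + 1/2, j + 1)`, hence `a'_{δ-ε} = a_{j-i+1}`; the horizontal side between `(i, j)` and
`(i+1, j)` has midpoint `(i + 1, j + 1/2)`, hence `a'_{δ-ε} = a_{j-i}`. -/
noncomputable def hookWeight {R : Type*} [CommRing R] [Algebra ℂ R]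
    (a : ℤ → ℂ) (nu : Finset (ℕ × ℕ)) (u v : R) : R :=
  (u + v) *
    (∏ s ∈ nu.filter (fun s => (s.1, s.2 + 1) ∈ nu), (u - algebraMap ℂ R (a (content s + 1)))) *
    (∏ s ∈ nu.filter (fun s => (s.1 + 1, s.2) ∈ nu), (v + algebraMap ℂ R (a (content s))))

/-- The polynomial `f_{ν;a}(u, v)` of a skew diagram `ν` without `2 × 2` blocks: the product of the
weights of its connected components, which are skew hooks. In particular `f_{∅;a} = 1`. -/
noncomputable def fWeight {R : Type*} [CommRing R] [Algebra ℂ R]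
    (a : ℤ → ℂ) (nu : Finset (ℕ × ℕ)) (u v : R) : R :=
  ∏ C ∈ components nu, hookWeight a C u v

/-! ## Tableaux

The entries are taken from a linearly ordered set `α`, which is `ℕ` in the place of `{1 < 2 < ⋯}`
and `Fin n` in the place of `{1 < ⋯ < n}`. -/

/-- The squares of the skew diagram `λ/μ`. -/
def skewCells (la mu : YoungDiagram) : Finset (ℕ × ℕ) := la.cells \ mu.cells

/-- Diagonal-strict tableaux: weakly increasing along rows and down columns, and strictly
increasing along diagonals. -/
def IsDiagonalStrict {α : Type*} [LinearOrder α] {nu : Finset (ℕ × ℕ)} (T : nu → α) : Prop :=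
  (∀ s t : nu, s.1.1 = t.1.1 → s.1.2 ≤ t.1.2 → T s ≤ T t) ∧
  (∀ s t : nu, s.1.2 = t.1.2 → s.1.1 ≤ t.1.1 → T s ≤ T t) ∧
  (∀ s t : nu, content s.1 = content t.1 → s.1.1 < t.1.1 → T s < T t)

/-- The set of squares `T⁻¹(i)`. -/
def preimage {α : Type*} [LinearOrder α] {nu : Finset (ℕ × ℕ)} (T : nu → α) (i : α) :
    Finset (ℕ × ℕ) :=
  (Finset.univ.filter fun s : nu => T s = i).map (Function.Embedding.subtype _)

/-- The contribution `∏_i f_{T⁻¹(i);a}(x_i, y_i)` of a diagonal-strict tableau; the factor is `1` if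
`i` is not an entry of `T`. -/
noncomputable def diagonalWeight {α : Type*} [LinearOrder α] {R : Type*} [CommRing R] [Algebra ℂ R]
    (a : ℤ → ℂ) (x y : α → R) {nu : Finset (ℕ × ℕ)} (T : nu → α) : R :=
  ∏ i ∈ Finset.univ.image T, fWeight a (preimage T i) (x i) (y i)

/-- The alphabet `{1' < 1 < 2' < 2 < ⋯}`: the letter `i'` is `(i, false)`, and the letter `i` is
`(i, true)`; the order is lexicographic. -/
abbrev Letter (α : Type*) : Type _ := α ×ₗ Bool

/-- `|i'| = |i| = i`. -/
def Letter.abs {α : Type*} (l : Letter α) : α := (ofLex l).1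

/-- The letter is one of `1', 2', …`. -/
def Letter.IsPrimed {α : Type*} (l : Letter α) : Prop := (ofLex l).2 = false

instance {α : Type*} (l : Letter α) : Decidable l.IsPrimed :=
  inferInstanceAs (Decidable ((ofLex l).2 = false))

/-- `𝔸`-tableaux: weakly increasing along rows and down columns, with at most one `i'` in each row
and at most one `i` in each column. -/
def IsATableau {α : Type*} [LinearOrder α] {nu : Finset (ℕ × ℕ)} (T : nu → Letter α) : Prop :=
  (∀ s t : nu, s.1.1 = t.1.1 → s.1.2 ≤ t.1.2 → T s ≤ T t) ∧
  (∀ s t : nu, s.1.2 = t.1.2 → s.1.1 ≤ t.1.1 → T s ≤ T t) ∧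
  (∀ s t : nu, s.1.1 = t.1.1 → (T s).IsPrimed → T s = T t → s = t) ∧
  (∀ s t : nu, s.1.2 = t.1.2 → ¬ (T s).IsPrimed → T s = T t → s = t)

/-- The contribution of an `𝔸`-tableau: a factor `x_{T(s)} - a_{c(s)}` for each square `s` with an
unprimed entry, and a factor `y_{|T(s)|} + a_{c(s)}` for each square with a primed entry. -/
noncomputable def aWeight {α : Type*} {R : Type*} [CommRing R] [Algebra ℂ R]
    (a : ℤ → ℂ) (x y : α → R) {nu : Finset (ℕ × ℕ)} (T : nu → Letter α) : R :=
  (∏ s ∈ Finset.univ.filter (fun s : nu => ¬ (T s).IsPrimed),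
      (x (T s).abs - algebraMap ℂ R (a (content s.1)))) *
    ∏ s ∈ Finset.univ.filter (fun s : nu => (T s).IsPrimed),
      (y (T s).abs + algebraMap ℂ R (a (content s.1)))

/-! ## Combinatorial sums -/

open Classical in
/-- The sum over the diagonal-strict tableaux of shape `nu` with entries in `{1, …, n}`. -/
noncomputable def diagonalSum {R : Type*} [CommRing R] [Algebra ℂ R] {n : ℕ}
    (a : ℤ → ℂ) (nu : Finset (ℕ × ℕ)) (x y : Fin n → R) : R :=
  ∑ T ∈ (Finset.univ : Finset (nu → Fin n)).filter (fun T => IsDiagonalStrict T),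
    diagonalWeight a x y T

open Classical in
/-- The sum over the `𝔸`-tableaux of shape `nu` with entries in `{1' < 1 < ⋯ < n' < n}`. -/
noncomputable def aSum {R : Type*} [CommRing R] [Algebra ℂ R] {n : ℕ}
    (a : ℤ → ℂ) (nu : Finset (ℕ × ℕ)) (x y : Fin n → R) : R :=
  ∑ T ∈ (Finset.univ : Finset (nu → Fin n × Bool)).filter
      (fun T => IsATableau fun s => (toLex (T s) : Letter (Fin n))),
    aWeight a x y fun s => (toLex (T s) : Letter (Fin n))

open Classical in
/-- The sum of the contributions of the finitely many `𝔸`-tableaux which become `T` when all primes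
are erased (`e s = false` means that the entry of the square `s` is primed). -/
noncomputable def aSumOver {α : Type*} [LinearOrder α] {R : Type*} [CommRing R] [Algebra ℂ R]
    (a : ℤ → ℂ) (x y : α → R) {nu : Finset (ℕ × ℕ)} (T : nu → α) : R :=
  ∑ e ∈ (Finset.univ : Finset (nu → Bool)).filter
      (fun e => IsATableau fun s => (toLex (T s, e s) : Letter α)),
    aWeight a x y fun s => (toLex (T s, e s) : Letter α)

/-- The variables `x_1, …, x_n`. -/
noncomputable def xFin (n : ℕ) (i : Fin n) : MvPolynomial (Fin n ⊕ Fin n) ℂ :=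
  MvPolynomial.X (Sum.inl i)

/-- The variables `y_1, …, y_n`. -/
noncomputable def yFin (n : ℕ) (i : Fin n) : MvPolynomial (Fin n ⊕ Fin n) ℂ :=
  MvPolynomial.X (Sum.inr i)

/-- The variables `x_1, x_2, …`. -/
noncomputable def xInf (i : ℕ) : MvPowerSeries (ℕ ⊕ ℕ) ℂ := MvPowerSeries.X (Sum.inl i)

/-- The variables `y_1, y_2, …`. -/
noncomputable def yInf (i : ℕ) : MvPowerSeries (ℕ ⊕ ℕ) ℂ := MvPowerSeries.X (Sum.inr i)

end MultiSchur

open MultiSchur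

/-! Let `hMatrix H a l m` be h_{l-m; τ^m a}, computed from a series H. With rows counted from 0,
s_{λ/μ} is its minor with rows λ_i - i and columns μ_j - j (`shapeDet`). If G = H·(u + y)/(u - x),
the matrices satisfy G(l,m) = H(l,m) + (y + a_{l-1}) H(l-1,m) + (x - a_{l-1}) G(l-1,m)
(`hMatrix_recursion`). For l = λ_i - i the number l - 1 is the content of the last square of row i,
so the two coefficients are the weights of a primed and of an unprimed letter in that square.

The recursion is performed in two stages. The y-stage expands minors over vertical strips
(`shapeDet_vertical`), the x-stage over horizontal strips (`shapeDet_horizontal`). In a tableau the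
squares with the largest letter form exactly such a strip (`tableauSum_insert`). The empty alphabet
gives the identity matrix, and induction on the letters identifies the minors with the sums over
𝔸-tableaux (`represents_hMatrix`).

To pass to diagonal-strict tableaux, erase the primes. In the set of squares with a given absolute
value, a square with a left neighbour must be unprimed and one with a lower neighbour must be
primed. Diagonal strictness says that no square has both, and then each connected component has
exactly one square whose prime is free (`existsUnique_free`). That square contributes (u - a_c) + (v
+ a_c) = u + v, the others contribute the factors attached to interior sides
(`aSumOver_eq_diagonalWeight`).

The super realization sends H(u) to ∏ (u + y_i)/(u - x_i), since both have the same logarithmic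
derivative (`map_completeSeries`); hence s_{μ;a} is the skew case with empty inner shape. In
infinitely many variables, a coefficient involves finitely many variables and can be read off after
the others are set to zero. -/

namespace MultiSchur

/-! ## Ribbons -/

/-- The left neighbour of the square `s` belongs to `nu`. -/
def HasLeft (nu : Finset (ℕ × ℕ)) (s : ℕ × ℕ) : Prop := ∃ j, s.2 = j + 1 ∧ (s.1, j) ∈ nu

/-- The lower neighbour of the square `s` belongs to `nu`. -/
def HasBelow (nu : Finset (ℕ × ℕ)) (s : ℕ × ℕ) : Prop := (s.1 + 1, s.2) ∈ nu

open Classical in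
/-- One step to the left if possible, else one step downwards if possible. -/
noncomputable def ribbonStep (nu : Finset (ℕ × ℕ)) (s : ℕ × ℕ) : ℕ × ℕ :=
  if HasLeft nu s then (s.1, s.2 - 1) else if HasBelow nu s then (s.1 + 1, s.2) else s

/-- No square has both a left and a lower neighbour. -/
def IsThin (nu : Finset (ℕ × ℕ)) : Prop := ∀ s ∈ nu, HasLeft nu s → ¬ HasBelow nu s

/-- Neighbouring squares of `nu`. -/
def Linked (nu : Finset (ℕ × ℕ)) (p q : ℕ × ℕ) : Prop := p ∈ nu ∧ q ∈ nu ∧ Adj p q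

theorem Linked.symm {nu : Finset (ℕ × ℕ)} {p q : ℕ × ℕ} (h : Linked nu p q) : Linked nu q p := by
  obtain ⟨hp, hq, h⟩ := h
  refine ⟨hq, hp, ?_⟩
  unfold Adj at *
  omega

theorem mem_component {nu : Finset (ℕ × ℕ)} {s t : ℕ × ℕ} :
    t ∈ component nu s ↔ t ∈ nu ∧ Relation.ReflTransGen (Linked nu) s t := by
  simp only [component, Finset.mem_filter]
  rfl

theorem ribbonStep_mem {nu : Finset (ℕ × ℕ)} {s : ℕ × ℕ} (hs : s ∈ nu) : ribbonStep nu s ∈ nu := by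
  unfold ribbonStep
  split_ifs with h1 h2
  · obtain ⟨j, hj, h⟩ := h1
    simpa [hj] using h
  · exact h2
  · exact hs

theorem ribbonStep_of_free {nu : Finset (ℕ × ℕ)} {s : ℕ × ℕ} (h1 : ¬ HasLeft nu s)
    (h2 : ¬ HasBelow nu s) : ribbonStep nu s = s := by
  simp [ribbonStep, h1, h2]

theorem reflTransGen_ribbonStep {nu : Finset (ℕ × ℕ)} {s : ℕ × ℕ} (hs : s ∈ nu) :
    Relation.ReflTransGen (Linked nu) s (ribbonStep nu s) := by
  have hm := ribbonStep_mem hs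
  unfold ribbonStep at *
  split_ifs at * with h1 h2
  · obtain ⟨j, hj, h⟩ := h1
    refine .single ⟨hs, hm, Or.inl ⟨rfl, Or.inr ?_⟩⟩
    simp [hj]
  · exact .single ⟨hs, hm, Or.inr ⟨rfl, Or.inl rfl⟩⟩
  · exact .refl

theorem iterate_ribbonStep_mem {nu : Finset (ℕ × ℕ)} {s : ℕ × ℕ} (hs : s ∈ nu) (k : ℕ) :
    (ribbonStep nu)^[k] s ∈ nu ∧
      Relation.ReflTransGen (Linked nu) s ((ribbonStep nu)^[k] s) := by
  induction k with
  | zero => exact ⟨hs, .refl⟩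
  | succ k ih =>
    rw [Function.iterate_succ_apply']
    exact ⟨ribbonStep_mem ih.1, ih.2.trans (reflTransGen_ribbonStep ih.1)⟩

/-- If `B` bounds all coordinates, every nontrivial step lowers column + (`B` - row), so a single
number of iterations serves all squares. -/
theorem exists_iterate_free (nu : Finset (ℕ × ℕ)) : ∃ K, ∀ s ∈ nu,
    ¬ HasLeft nu ((ribbonStep nu)^[K] s) ∧ ¬ HasBelow nu ((ribbonStep nu)^[K] s) := by
  obtain ⟨B, hB⟩ : ∃ B, ∀ s ∈ nu, s.1 < B ∧ s.2 < B := by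
    refine ⟨(nu.sup fun s => s.1 + s.2) + 1, fun s hs => ?_⟩
    have := Finset.le_sup (f := fun s : ℕ × ℕ => s.1 + s.2) hs
    have : s.1 + s.2 ≤ nu.sup fun s => s.1 + s.2 := this
    omega
  have key : ∀ k, ∀ s ∈ nu, s.2 + (B - s.1) ≤ k →
      ¬ HasLeft nu ((ribbonStep nu)^[k] s) ∧ ¬ HasBelow nu ((ribbonStep nu)^[k] s) := by
    intro k
    induction k with
    | zero =>
      intro s hs h
      have := hB s hs
      omega
    | succ k ih =>
      intro s hs h
      by_cases hf : ¬ HasLeft nu s ∧ ¬ HasBelow nu s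
      · have hfix := ribbonStep_of_free hf.1 hf.2
        rw [Function.iterate_fixed hfix]
        exact hf
      · rw [Function.iterate_succ_apply]
        refine ih _ (ribbonStep_mem hs) ?_
        have h1 := hB s hs
        have h2 := hB _ (ribbonStep_mem hs)
        unfold ribbonStep at *
        split_ifs at * with h3 h4
        · obtain ⟨j, hj, -⟩ := h3
          simp only
          omega
        · simp only at *
          omega
        · exact absurd ⟨h3, h4⟩ hf
  refine ⟨2 * B, fun s hs => key _ s hs ?_⟩
  have := hB s hs
  omega

/-- A left step always has priority, and in a vertical pair thinness denies the upper square a left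
neighbour, so its step goes down. Every adjacency is therefore traversed by `ribbonStep` in one
direction. -/
theorem Linked.ribbonStep_eq {nu : Finset (ℕ × ℕ)} (hthin : IsThin nu) {p q : ℕ × ℕ}
    (h : Linked nu p q) : ribbonStep nu p = q ∨ ribbonStep nu q = p := by
  have left : ∀ s t : ℕ × ℕ, s ∈ nu → s.1 = t.1 → s.2 + 1 = t.2 → ribbonStep nu t = s := by
    intro s t hs h1 h2
    have : HasLeft nu t := ⟨s.2, h2.symm, by rw [← h1]; exact hs⟩
    rw [ribbonStep, if_pos this]
    ext
    · exact h1.symm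
    · simp only
      omega
  have below : ∀ s t : ℕ × ℕ, s ∈ nu → t ∈ nu → s.2 = t.2 → s.1 + 1 = t.1 →
      ribbonStep nu s = t := by
    intro s t hs ht h1 h2
    have hb : HasBelow nu s := by rw [HasBelow, h2, h1]; exact ht
    have hl : ¬ HasLeft nu s := fun hl => hthin s hs hl hb
    rw [ribbonStep, if_neg hl, if_pos hb, h2, h1]
  obtain ⟨hp, hq, ⟨h1, h2 | h2⟩ | ⟨h1, h2 | h2⟩⟩ := h
  · exact Or.inr (left p q hp h1 h2)
  · exact Or.inl (left q p hq h1.symm h2)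
  · exact Or.inl (below p q hp hq h1 h2)
  · exact Or.inr (below q p hq hp h1.symm h2)

/-- Each component of a thin set contains exactly one square without left and lower neighbours. -/
theorem existsUnique_free {nu : Finset (ℕ × ℕ)} (hthin : IsThin nu) {s : ℕ × ℕ} (hs : s ∈ nu) :
    ∃ f ∈ component nu s, (¬ HasLeft nu f ∧ ¬ HasBelow nu f) ∧
      ∀ g ∈ component nu s, ¬ HasLeft nu g → ¬ HasBelow nu g → g = f := by
  obtain ⟨K, hK⟩ := exists_iterate_free nu
  have step : ∀ p ∈ nu, (ribbonStep nu)^[K] (ribbonStep nu p) = (ribbonStep nu)^[K] p := by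
    intro p hp
    rw [← Function.iterate_succ_apply, Function.iterate_succ_apply']
    exact ribbonStep_of_free (hK p hp).1 (hK p hp).2
  -- The terminal square of the path is an invariant of the component, and a free square is its own
  -- terminal square; this gives uniqueness.
  have const : ∀ t, Relation.ReflTransGen (Linked nu) s t →
      (ribbonStep nu)^[K] t = (ribbonStep nu)^[K] s := by
    intro t h
    induction h with
    | refl => rfl
    | tail _ h ih =>
      rw [← ih]
      rcases h.ribbonStep_eq hthin with e | e
      · rw [← e, step _ h.1]
      · rw [← step _ h.2.1, e]
  refine ⟨(ribbonStep nu)^[K] s, mem_component.2 (iterate_ribbonStep_mem hs K), hK s hs, ?_⟩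
  intro g hg h1 h2
  rw [← const g (mem_component.1 hg).2]
  exact (Function.iterate_fixed (ribbonStep_of_free h1 h2) K).symm

theorem mem_component_of_adj {nu : Finset (ℕ × ℕ)} {r s t : ℕ × ℕ} (hs : s ∈ component nu r)
    (ht : t ∈ nu) (h : Adj s t) : t ∈ component nu r := by
  rw [mem_component] at *
  exact ⟨ht, hs.2.tail ⟨hs.1, ht, h⟩⟩

theorem component_subset {nu : Finset (ℕ × ℕ)} {r : ℕ × ℕ} : component nu r ⊆ nu :=
  fun _ h => (mem_component.1 h).1

theorem hasLeft_component {nu : Finset (ℕ × ℕ)} {r s : ℕ × ℕ} (hs : s ∈ component nu r) :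
    HasLeft (component nu r) s ↔ HasLeft nu s := by
  constructor
  · rintro ⟨j, hj, h⟩
    exact ⟨j, hj, component_subset h⟩
  · rintro ⟨j, hj, h⟩
    exact ⟨j, hj, mem_component_of_adj hs h (Or.inl ⟨rfl, Or.inr hj.symm⟩)⟩

theorem hasBelow_component {nu : Finset (ℕ × ℕ)} {r s : ℕ × ℕ} (hs : s ∈ component nu r) :
    HasBelow (component nu r) s ↔ HasBelow nu s :=
  ⟨fun h => component_subset h, fun h => mem_component_of_adj hs h (Or.inr ⟨rfl, Or.inl rfl⟩)⟩

theorem component_eq_iff {nu : Finset (ℕ × ℕ)} {s t : ℕ × ℕ} (ht : t ∈ nu) :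
    component nu t = component nu s ↔ t ∈ component nu s := by
  constructor
  · intro h
    rw [← h, mem_component]
    exact ⟨ht, .refl⟩
  · intro h
    have h1 := (mem_component.1 h).2
    have : Std.Symm (Linked nu) := ⟨fun _ _ h => h.symm⟩
    have h2 : Relation.ReflTransGen (Linked nu) t s := Relation.ReflTransGen.stdSymm.symm _ _ h1
    ext r
    rw [mem_component, mem_component]
    exact ⟨fun h => ⟨h.1, h1.trans h.2⟩, fun h => ⟨h.1, h2.trans h.2⟩⟩

open Classical in
/-- The sum of the weights of the letters which the square `s` of a thin set can carry: it is
unprimed if it has a left neighbour, and primed if it has a lower neighbour. -/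
noncomputable def squareWeight {R : Type*} [CommRing R] [Algebra ℂ R]
    (a : ℤ → ℂ) (nu : Finset (ℕ × ℕ)) (u v : R) (s : ℕ × ℕ) : R :=
  (if HasBelow nu s then 0 else u - algebraMap ℂ R (a (content s))) +
    if HasLeft nu s then 0 else v + algebraMap ℂ R (a (content s))

open Classical in
-- At every square but the free one exactly one summand of `squareWeight` survives; at the free one
-- the parameters cancel and leave `u + v`.
theorem prod_squareWeight_component {R : Type*} [CommRing R] [Algebra ℂ R]
    (a : ℤ → ℂ) {nu : Finset (ℕ × ℕ)} (hthin : IsThin nu) (u v : R) {r : ℕ × ℕ} (hr : r ∈ nu) :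
    ∏ s ∈ component nu r, squareWeight a nu u v s = hookWeight a (component nu r) u v := by
  obtain ⟨f, hf, hff, huniq⟩ := existsUnique_free hthin hr
  set C := component nu r with hC
  have h1 : ∀ s ∈ C, squareWeight a nu u v s =
      (if s = f then u + v else 1) *
      (if HasLeft C s then u - algebraMap ℂ R (a (content s)) else 1) *
      (if HasBelow C s then v + algebraMap ℂ R (a (content s)) else 1) := by
    intro s hs
    rw [hasLeft_component hs, hasBelow_component hs, squareWeight]
    by_cases hl : HasLeft nu s
    · have hb := hthin s (component_subset hs) hl
      have : s ≠ f := by rintro rfl; exact hff.1 hl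
      simp [hl, hb, this]
    · by_cases hb : HasBelow nu s
      · have : s ≠ f := by rintro rfl; exact hff.2 hb
        simp [hl, hb, this]
      · rw [if_neg hl, if_neg hb, if_neg hl, if_neg hb, if_pos (huniq s hs hl hb)]
        ring
  rw [Finset.prod_congr rfl h1, Finset.prod_mul_distrib, Finset.prod_mul_distrib, hookWeight,
    Finset.prod_ite_eq' C f, if_pos hf, ← Finset.prod_filter, ← Finset.prod_filter]
  refine congr_arg₂ _ (congr_arg _ ?_) (Finset.prod_congr (by ext; rw [Finset.mem_filter, Finset.mem_filter]; rfl) fun _ _ => rfl)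
  -- `hookWeight` indexes a vertical side by its left square, `squareWeight` puts the factor on the
  -- right square; the contents differ by 1.
  · refine Finset.prod_nbij' (fun s => (s.1, s.2 - 1)) (fun s => (s.1, s.2 + 1)) ?_ ?_ ?_ ?_ ?_
    · intro s hs
      obtain ⟨hs, j, hj, h⟩ := Finset.mem_filter.1 hs
      refine Finset.mem_filter.2 ⟨by simpa [hj] using h, ?_⟩
      have : s.2 - 1 + 1 = s.2 := by omega
      simpa only [this] using hs
    · intro s hs
      obtain ⟨hs, h⟩ := Finset.mem_filter.1 hs
      exact Finset.mem_filter.2 ⟨h, s.2, rfl, hs⟩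
    · intro s hs
      obtain ⟨hs, j, hj, h⟩ := Finset.mem_filter.1 hs
      ext <;> simp only
      omega
    · intro s hs
      simp
    · intro s hs
      obtain ⟨hs, j, hj, h⟩ := Finset.mem_filter.1 hs
      have : content s = content (s.1, s.2 - 1) + 1 := by
        simp only [content]
        omega
      rw [this]

theorem fWeight_eq_prod_squareWeight {R : Type*} [CommRing R] [Algebra ℂ R]
    (a : ℤ → ℂ) {nu : Finset (ℕ × ℕ)} (hthin : IsThin nu) (u v : R) :
    fWeight a nu u v = ∏ s ∈ nu, squareWeight a nu u v s := by
  classical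
  rw [fWeight, ← Finset.prod_fiberwise_of_maps_to (s := nu) (t := components nu)
    (g := component nu) (fun s hs => Finset.mem_image_of_mem _ hs)]
  refine Finset.prod_congr rfl fun C hC => ?_
  obtain ⟨r, hr, rfl⟩ := Finset.mem_image.1 hC
  rw [← prod_squareWeight_component a hthin u v hr]
  refine Finset.prod_congr ?_ fun _ _ => rfl
  ext s
  rw [Finset.mem_filter]
  exact ⟨fun h => ⟨component_subset h, (component_eq_iff (component_subset h)).2 h⟩,
    fun h => (component_eq_iff h.1).1 h.2⟩

/-! ## Erasing the primes -/

/-- Weakly increasing along rows and down columns. -/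
def IsRowColMono {α : Type*} [LinearOrder α] {nu : Finset (ℕ × ℕ)} (T : nu → α) : Prop :=
  (∀ s t : nu, s.1.1 = t.1.1 → s.1.2 ≤ t.1.2 → T s ≤ T t) ∧
  (∀ s t : nu, s.1.2 = t.1.2 → s.1.1 ≤ t.1.1 → T s ≤ T t)

theorem mem_preimage {α : Type*} [LinearOrder α] {nu : Finset (ℕ × ℕ)} {T : nu → α} {i : α}
    {s : ℕ × ℕ} : s ∈ preimage T i ↔ ∃ h : s ∈ nu, T ⟨s, h⟩ = i := by
  simp [preimage]

theorem letter_le_iff {α : Type*} [LinearOrder α] {i j : α} {b c : Bool} :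
    (toLex (i, b) : Letter α) ≤ toLex (j, c) ↔ i < j ∨ i = j ∧ b ≤ c := by
  rw [Prod.Lex.toLex_le_toLex]

/-- Of two horizontal neighbours with the same absolute value the right one is unprimed, else both
would be the same primed letter; dually for columns. Order-convexity reduces distant squares to
neighbours, so the conditions on the primes become local. -/
theorem isATableau_iff {α : Type*} [LinearOrder α] {nu : Finset (ℕ × ℕ)}
    (hnu : (nu : Set (ℕ × ℕ)).OrdConnected) (T : nu → α) (e : nu → Bool) :
    (IsATableau fun s => (toLex (T s, e s) : Letter α)) ↔
      IsRowColMono T ∧ ∀ s : nu, (HasBelow (preimage T (T s)) s → e s = false) ∧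
        (HasLeft (preimage T (T s)) s → e s = true) := by
  -- The square just left of `t` lies in `nu` by convexity, and its entry is squeezed between two
  -- equal ones.
  have hrow : IsRowColMono T → ∀ s t : nu, s.1.1 = t.1.1 → s.1.2 < t.1.2 → T s = T t →
      HasLeft (preimage T (T t)) t := by
    intro hT s t h1 h2 h3
    refine ⟨t.1.2 - 1, by omega, mem_preimage.2 ⟨?_, ?_⟩⟩
    · refine hnu.out s.2 t.2 ⟨⟨h1.le, ?_⟩, ⟨le_rfl, ?_⟩⟩ <;> simp only <;> omega
    · refine le_antisymm ?_ (h3 ▸ ?_)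
      · refine hT.1 _ _ rfl ?_
        simp only
        omega
      · refine hT.1 _ _ h1 ?_
        simp only
        omega
  have hcol : IsRowColMono T → ∀ s t : nu, s.1.2 = t.1.2 → s.1.1 < t.1.1 → T s = T t →
      HasBelow (preimage T (T s)) s := by
    intro hT s t h1 h2 h3
    refine mem_preimage.2 ⟨?_, ?_⟩
    · refine hnu.out s.2 t.2 ⟨⟨?_, le_rfl⟩, ⟨?_, h1.le⟩⟩ <;> simp only <;> omega
    · refine le_antisymm (h3 ▸ ?_) ?_
      · refine hT.2 _ _ rfl ?_
        simp only
        omega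
      · refine hT.2 _ _ h1 ?_
        simp only
        omega
  constructor
  · rintro ⟨h1, h2, h3, h4⟩
    simp only [letter_le_iff] at h1 h2
    refine ⟨⟨fun s t hs ht => ?_, fun s t hs ht => ?_⟩, fun s => ⟨fun hb => ?_, ?_⟩⟩
    · rcases h1 s t hs ht with h | h
      exacts [h.le, h.1.le]
    · rcases h2 s t hs ht with h | h
      exacts [h.le, h.1.le]
    · obtain ⟨hm, hT⟩ := mem_preimage.1 hb
      by_contra he
      rw [Bool.not_eq_false] at he
      have h5 := h2 s ⟨_, hm⟩ rfl (Nat.le_succ _)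
      rw [hT, he] at h5
      have h6 : e ⟨_, hm⟩ = true := by
        rcases h5 with h | h
        · exact absurd h (lt_irrefl _)
        · exact top_le_iff.1 h.2
      have := h4 s ⟨_, hm⟩ rfl (by simp [Letter.IsPrimed, he]) (by simp only [hT, he, h6])
      have := congrArg (fun t : nu => t.1.1) this
      simp at this
    · rintro ⟨j, hj, hb⟩
      obtain ⟨hm, hT⟩ := mem_preimage.1 hb
      by_contra he
      rw [Bool.not_eq_true] at he
      have h5 := h1 ⟨_, hm⟩ s rfl (by simp only; omega)
      rw [hT, he] at h5
      have h6 : e ⟨_, hm⟩ = false := by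
        rcases h5 with h | h
        · exact absurd h (lt_irrefl _)
        · exact le_bot_iff.1 h.2
      have := h3 ⟨_, hm⟩ s rfl (by simp [Letter.IsPrimed, h6]) (by simp only [hT, he, h6])
      have := congrArg (fun t : nu => t.1.2) this
      simp only at this
      omega
  · rintro ⟨hT, he⟩
    refine ⟨fun s t hs ht => ?_, fun s t hs ht => ?_, fun s t hs hp h => ?_,
      fun s t hs hp h => ?_⟩
    · rw [letter_le_iff]
      rcases (hT.1 s t hs ht).lt_or_eq with h | h
      · exact Or.inl h
      · refine Or.inr ⟨h, ?_⟩
        rcases ht.lt_or_eq with h' | h'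
        · rw [(he t).2 (hrow hT s t hs h' h)]
          exact le_top
        · rw [show s = t from Subtype.ext (Prod.ext hs h')]
    · rw [letter_le_iff]
      rcases (hT.2 s t hs ht).lt_or_eq with h | h
      · exact Or.inl h
      · refine Or.inr ⟨h, ?_⟩
        rcases ht.lt_or_eq with h' | h'
        · rw [(he s).1 (hcol hT s t hs h' h)]
          exact bot_le
        · rw [show s = t from Subtype.ext (Prod.ext h' hs)]
    · have h := congrArg ofLex h
      simp only [ofLex_toLex, Prod.mk.injEq] at h
      have hp : e s = false := hp
      rcases lt_trichotomy s.1.2 t.1.2 with h' | h' | h'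
      · have := (he t).2 (hrow hT s t hs h' h.1)
        simp_all
      · exact Subtype.ext (Prod.ext hs h')
      · have := (he s).2 (hrow hT t s hs.symm h' h.1.symm)
        simp_all
    · have h := congrArg ofLex h
      simp only [ofLex_toLex, Prod.mk.injEq] at h
      have hp : ¬ e s = false := hp
      rcases lt_trichotomy s.1.1 t.1.1 with h' | h' | h'
      · exact absurd ((he s).1 (hcol hT s t hs h' h.1)) hp
      · exact Subtype.ext (Prod.ext h' hs)
      · have := (he t).1 (hcol hT t s hs.symm h' h.1.symm)
        simp_all

/-- The left and the lower neighbour of a square lie on the same diagonal. -/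
theorem isThin_preimage {α : Type*} [LinearOrder α] {nu : Finset (ℕ × ℕ)} {T : nu → α}
    (hT : IsDiagonalStrict T) (i : α) : IsThin (preimage T i) := by
  rintro s hs ⟨j, hj, hl⟩ hb
  obtain ⟨h1, e1⟩ := mem_preimage.1 hl
  obtain ⟨h2, e2⟩ := mem_preimage.1 hb
  have := hT.2.2 ⟨_, h1⟩ ⟨_, h2⟩ (by simp only [content]; omega) (by simp)
  rw [e1, e2] at this
  exact lt_irrefl _ this

/-- Equality along a diagonal would force equal entries at `s`, at the square to its right, and at
the square below that one; the middle square would then have to be both primed and unprimed. -/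
theorem isDiagonalStrict_of_isATableau {α : Type*} [LinearOrder α] {nu : Finset (ℕ × ℕ)}
    (hnu : (nu : Set (ℕ × ℕ)).OrdConnected) {T : nu → α} {e : nu → Bool}
    (h : IsATableau fun s => (toLex (T s, e s) : Letter α)) : IsDiagonalStrict T := by
  obtain ⟨hT, he⟩ := (isATableau_iff hnu T e).1 h
  refine ⟨hT.1, hT.2, fun s t hc hlt => ?_⟩
  simp only [content] at hc
  have m1 : (s.1.1, s.1.2 + 1) ∈ nu := by
    refine hnu.out s.2 t.2 ⟨⟨le_rfl, ?_⟩, ⟨?_, ?_⟩⟩ <;> simp only <;> omega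
  have m2 : (s.1.1 + 1, s.1.2 + 1) ∈ nu := by
    refine hnu.out s.2 t.2 ⟨⟨?_, ?_⟩, ⟨?_, ?_⟩⟩ <;> simp only <;> omega
  have m3 : (s.1.1 + 1, t.1.2) ∈ nu := by
    refine hnu.out s.2 t.2 ⟨⟨?_, ?_⟩, ⟨?_, le_rfl⟩⟩ <;> simp only <;> omega
  have l1 : T s ≤ T ⟨_, m1⟩ := hT.1 _ _ rfl (by simp)
  have l2 : T ⟨_, m1⟩ ≤ T ⟨_, m2⟩ := hT.2 _ _ rfl (by simp)
  have l3 : T ⟨_, m2⟩ ≤ T ⟨_, m3⟩ := hT.1 _ _ rfl (by simp only; omega)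
  have l4 : T ⟨_, m3⟩ ≤ T t := hT.2 _ _ rfl (by simp only; omega)
  refine lt_of_le_of_ne (l1.trans (l2.trans (l3.trans l4))) fun heq => ?_
  have e1 : T s = T ⟨_, m1⟩ := le_antisymm l1 (heq ▸ l2.trans (l3.trans l4))
  have e2 : T ⟨_, m2⟩ = T ⟨_, m1⟩ :=
    le_antisymm (e1 ▸ heq ▸ l3.trans l4) l2
  have b := (he ⟨_, m1⟩).1 (mem_preimage.2 ⟨m2, e2⟩)
  have c := (he ⟨_, m1⟩).2 ⟨_, rfl, mem_preimage.2 ⟨s.2, e1⟩⟩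
  rw [b] at c
  exact absurd c (by decide)

theorem aWeight_toLex {α : Type*} {R : Type*} [CommRing R] [Algebra ℂ R]
    (a : ℤ → ℂ) (x y : α → R) {nu : Finset (ℕ × ℕ)} (T : nu → α) (e : nu → Bool) :
    (aWeight a x y fun s => (toLex (T s, e s) : Letter α)) =
      ∏ s : nu, if e s then x (T s) - algebraMap ℂ R (a (content s.1))
        else y (T s) + algebraMap ℂ R (a (content s.1)) := by
  rw [aWeight, mul_comm, Finset.prod_filter, Finset.prod_filter, ← Finset.prod_mul_distrib]
  refine Finset.prod_congr rfl fun s _ => ?_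
  cases h : e s <;> simp [Letter.IsPrimed, Letter.abs]

/-- The contribution of a diagonal-strict tableau is the sum over the `𝔸`-tableaux above it. -/
theorem aSumOver_eq_diagonalWeight {α : Type*} [LinearOrder α] {R : Type*} [CommRing R]
    [Algebra ℂ R] (a : ℤ → ℂ) (x y : α → R) {nu : Finset (ℕ × ℕ)}
    (hnu : (nu : Set (ℕ × ℕ)).OrdConnected) {T : nu → α} (hT : IsDiagonalStrict T) :
    aSumOver a x y T = diagonalWeight a x y T := by
  classical
  have hmono : IsRowColMono T := ⟨hT.1, hT.2.1⟩
  -- The conditions on the primes are imposed square by square, so the set of admissible choices is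
  -- a product and the sum factorizes.
  have h1 : (Finset.univ : Finset (nu → Bool)).filter
      (fun e => IsATableau fun s => (toLex (T s, e s) : Letter α)) =
      Fintype.piFinset fun s : nu => Finset.univ.filter fun b =>
        (HasBelow (preimage T (T s)) s → b = false) ∧
          (HasLeft (preimage T (T s)) s → b = true) := by
    ext e
    simp [isATableau_iff hnu, hmono]
  rw [aSumOver, h1]
  simp only [aWeight_toLex]
  rw [← Finset.prod_univ_sum (fun s : nu => Finset.univ.filter fun b =>
        (HasBelow (preimage T (T s)) s → b = false) ∧
          (HasLeft (preimage T (T s)) s → b = true))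
      (fun s b => if b = true then x (T s) - algebraMap ℂ R (a (content s.1))
        else y (T s) + algebraMap ℂ R (a (content s.1)))]
  have h2 : ∀ s : nu, (∑ b with (HasBelow (preimage T (T s)) s → b = false) ∧
          (HasLeft (preimage T (T s)) s → b = true),
        (if b = true then x (T s) - algebraMap ℂ R (a (content s.1))
        else y (T s) + algebraMap ℂ R (a (content s.1)))) =
      squareWeight a (preimage T (T s)) (x (T s)) (y (T s)) s := by
    intro s
    rw [Finset.sum_filter, Fintype.sum_bool, squareWeight]
    simp [imp_false, ite_not]
  rw [Finset.prod_congr rfl fun s _ => h2 s, diagonalWeight,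
    ← Finset.prod_fiberwise_of_maps_to (s := Finset.univ) (t := Finset.univ.image T) (g := T)
      (fun s hs => Finset.mem_image_of_mem _ hs)]
  refine Finset.prod_congr rfl fun i _ => ?_
  rw [fWeight_eq_prod_squareWeight a (isThin_preimage hT i)]
  conv_rhs => rw [preimage]
  rw [Finset.prod_map]
  refine Finset.prod_congr rfl fun s hs => ?_
  rw [(Finset.mem_filter.1 hs).2]
  rfl

/-- Group the 𝔸-tableaux by their absolute values; the groups over fillings that are not
diagonal-strict are empty. -/
theorem aSum_eq_diagonalSum {R : Type*} [CommRing R] [Algebra ℂ R] {n : ℕ}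
    (a : ℤ → ℂ) {nu : Finset (ℕ × ℕ)} (hnu : (nu : Set (ℕ × ℕ)).OrdConnected) (x y : Fin n → R) :
    aSum a nu x y = diagonalSum a nu x y := by
  classical
  have h : aSum a nu x y = ∑ T : nu → Fin n, aSumOver a x y T := by
    simp only [aSumOver, aSum, Finset.sum_filter]
    rw [← Fintype.sum_prod_type', ← (Equiv.arrowProdEquivProdArrow nu (fun _ => Fin n) (fun _ => Bool)).sum_comp]
    rfl
  rw [h, diagonalSum, Finset.sum_filter]
  refine Finset.sum_congr rfl fun T _ => ?_
  split_ifs with hT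
  · exact aSumOver_eq_diagonalWeight a x y hnu hT
  · refine Finset.sum_eq_zero fun e he => absurd ?_ hT
    exact isDiagonalStrict_of_isATableau hnu (Finset.mem_filter.1 he).2


/-! ## Removing the squares with the largest letter

Shapes are weakly decreasing sequences `la : Fin N → ℤ` of row lengths. -/

/-- The squares between the shapes `mu` and `la`. -/
def cells {N : ℕ} (la mu : Fin N → ℤ) : Finset (ℕ × ℕ) :=
  Finset.univ.biUnion fun i : Fin N =>
    (Finset.Ico (mu i).toNat (la i).toNat).image fun j => ((i : ℕ), j)

theorem mem_cells_iff {N : ℕ} {la mu : Fin N → ℤ} {s : ℕ × ℕ} :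
    s ∈ cells la mu ↔ ∃ i : Fin N, (i : ℕ) = s.1 ∧ mu i ≤ s.2 ∧ (s.2 : ℤ) < la i := by
  simp only [cells, Finset.mem_biUnion, Finset.mem_univ, true_and, Finset.mem_image,
    Finset.mem_Ico, Int.toNat_le, Int.lt_toNat]
  constructor
  · rintro ⟨i, j, h, rfl⟩
    exact ⟨i, rfl, h⟩
  · rintro ⟨i, h1, h2⟩
    exact ⟨i, s.2, h2, Prod.ext h1 rfl⟩

theorem mk_mem_cells {N : ℕ} {la mu : Fin N → ℤ} {i : Fin N} {j : ℕ} :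
    ((i : ℕ), j) ∈ cells la mu ↔ mu i ≤ j ∧ (j : ℤ) < la i := by
  rw [mem_cells_iff]
  constructor
  · rintro ⟨k, h1, h2⟩
    rwa [← Fin.ext h1]
  · intro h
    exact ⟨i, rfl, h⟩

/-- In terms of contents, row `i` is an interval shifted by `-i`. Nonnegativity keeps `toNat` in
`cells` from truncating. -/
theorem prod_cells {N : ℕ} {M : Type*} [CommMonoid M] {la mu : Fin N → ℤ} (hmu : 0 ≤ mu)
    (f : ℤ → M) :
    ∏ s ∈ cells la mu, f (content s) =
      ∏ i : Fin N, ∏ c ∈ Finset.Ico (mu i - i) (la i - i), f c := by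
  rw [cells, Finset.prod_biUnion]
  · refine Finset.prod_congr rfl fun i _ => ?_
    rw [Finset.prod_image fun j _ k _ h => congrArg Prod.snd h]
    have h0 : 0 ≤ mu i := hmu i
    refine Finset.prod_nbij' (fun j => (j : ℤ) - i) (fun c => (c + i).toNat) ?_ ?_ ?_ ?_ ?_
    · intro j hj
      simp only [Finset.mem_Ico] at *
      omega
    · intro j hj
      simp only [Finset.mem_Ico] at *
      omega
    · intro j hj
      simp
    · intro j hj
      simp only [Finset.mem_Ico] at *
      omega
    · intro j hj
      rfl
  · intro i _ k _ hik
    rw [Function.onFun, Finset.disjoint_left]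
    intro s hs ht
    obtain ⟨_, -, rfl⟩ := Finset.mem_image.1 hs
    obtain ⟨_, -, h⟩ := Finset.mem_image.1 ht
    exact hik (Fin.ext (congrArg Prod.fst h).symm)

/-- The shape `la / nu` is a vertical strip (`p` true) or a horizontal strip (`p` false). -/
def IsStrip {N : ℕ} (p : Prop) (la nu : Fin N → ℤ) : Prop :=
  nu ≤ la ∧ (p → ∀ i, la i ≤ nu i + 1) ∧ (¬ p → ∀ i j, i < j → la j ≤ nu i)

open Classical in
/-- The sum of the contributions of the `𝔸`-tableaux of shape `la / mu` with letters in `S`. -/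
noncomputable def tableauSum {N : ℕ} {α R : Type*} [LinearOrder α] [CommRing R]
    (w : Letter α → ℤ → R) (S : Finset (Letter α)) (la mu : Fin N → ℤ) : R :=
  ∑ T ∈ (Fintype.piFinset fun _ : cells la mu => S).filter IsATableau,
    ∏ s, w (T s) (content s.1)

open Classical in
/-- Extend a filling of `nu / mu` by the letter `m`. -/
noncomputable def glue {N : ℕ} {α : Type*} {nu mu : Fin N → ℤ} (la : Fin N → ℤ) (m : α)
    (T : cells nu mu → α) (s : cells la mu) : α :=
  if h : s.1 ∈ cells nu mu then T ⟨s.1, h⟩ else m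

theorem cells_mono_left {N : ℕ} {la nu mu : Fin N → ℤ} (h : nu ≤ la) :
    cells nu mu ⊆ cells la mu := by
  intro s hs
  rw [mem_cells_iff] at *
  obtain ⟨i, h1, h2, h3⟩ := hs
  exact ⟨i, h1, h2, h3.trans_le (h i)⟩

theorem cells_eq_union {N : ℕ} {la nu mu : Fin N → ℤ} (h1 : mu ≤ nu) (h2 : nu ≤ la) :
    cells la mu = cells nu mu ∪ cells la nu := by
  ext s
  simp only [Finset.mem_union, mem_cells_iff]
  constructor
  · rintro ⟨i, h3, h4, h5⟩
    by_cases h : (s.2 : ℤ) < nu i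
    · exact Or.inl ⟨i, h3, h4, h⟩
    · exact Or.inr ⟨i, h3, not_lt.1 h, h5⟩
  · rintro (⟨i, h3, h4, h5⟩ | ⟨i, h3, h4, h5⟩)
    · exact ⟨i, h3, h4, h5.trans_le (h2 i)⟩
    · exact ⟨i, h3, (h1 i).trans h4, h5⟩

theorem disjoint_cells {N : ℕ} (la nu mu : Fin N → ℤ) :
    Disjoint (cells nu mu) (cells la nu) := by
  rw [Finset.disjoint_left]
  intro s hs ht
  rw [mem_cells_iff] at *
  obtain ⟨i, h1, h2, h3⟩ := hs
  obtain ⟨j, h4, h5, h6⟩ := ht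
  obtain rfl : i = j := Fin.ext (h1.trans h4.symm)
  omega

theorem prod_glue {N : ℕ} {α R : Type*} [CommRing R] (w : α → ℤ → R) {la nu mu : Fin N → ℤ}
    (h0 : 0 ≤ mu) (h1 : mu ≤ nu) (h2 : nu ≤ la) (m : α) (T : cells nu mu → α) :
    ∏ s, w (glue la m T s) (content s.1) =
      (∏ i : Fin N, ∏ c ∈ Finset.Ico (nu i - i) (la i - i), w m c) *
        ∏ s, w (T s) (content s.1) := by
  classical
  have e1 : ∏ s, w (glue la m T s) (content s.1) = ∏ s ∈ cells la mu,
      w (if h : s ∈ cells nu mu then T ⟨s, h⟩ else m) (content s) :=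
    Finset.prod_coe_sort (cells la mu)
      (fun s => w (if h : s ∈ cells nu mu then T ⟨s, h⟩ else m) (content s))
  rw [e1, cells_eq_union h1 h2, Finset.prod_union (disjoint_cells la nu mu), mul_comm,
    ← prod_cells (h0.trans h1)]
  congr 1
  · refine Finset.prod_congr rfl fun s hs => ?_
    rw [dif_neg fun h => Finset.disjoint_left.1 (disjoint_cells la nu mu) h hs]
  · rw [← Finset.prod_coe_sort (cells nu mu)]
    refine Finset.prod_congr rfl fun s _ => ?_
    rw [dif_pos s.2]

/-- Since `m` exceeds every old letter, monotonicity only needs the old squares to come first, and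
the strip condition is the bound on repetitions of `m` in a row or column. -/
theorem isATableau_glue {N : ℕ} {α : Type*} [LinearOrder α] {S : Finset (Letter α)}
    {m : Letter α} (hm : ∀ l ∈ S, l < m) {la nu mu : Fin N → ℤ} (hnu : Antitone nu)
    (hs : IsStrip m.IsPrimed la nu)
    {T : cells nu mu → Letter α} (hTS : ∀ s, T s ∈ S) (hT : IsATableau T) :
    IsATableau (glue la m T) := by
  have lt : ∀ s, T s < m := fun s => hm _ (hTS s)
  have out : ∀ s : cells la mu, s.1 ∉ cells nu mu →
      ∃ i : Fin N, (i : ℕ) = s.1.1 ∧ nu i ≤ s.1.2 ∧ (s.1.2 : ℤ) < la i := by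
    intro s h
    obtain ⟨i, h3, h4, h5⟩ := mem_cells_iff.1 s.2
    refine ⟨i, h3, ?_, h5⟩
    by_contra h6
    exact h (mem_cells_iff.2 ⟨i, h3, h4, not_le.1 h6⟩)
  refine ⟨fun s t hst hle => ?_, fun s t hst hle => ?_, fun s t hst hp heq => ?_,
    fun s t hst hp heq => ?_⟩
  · unfold glue
    by_cases hs : s.1 ∈ cells nu mu <;> by_cases ht : t.1 ∈ cells nu mu
    · simpa [hs, ht] using hT.1 _ _ hst hle
    · simpa [hs, ht] using (lt _).le
    · obtain ⟨i, h3, h4, h5⟩ := out s hs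
      obtain ⟨j, h6, h7, h8⟩ := mem_cells_iff.1 ht
      obtain rfl : i = j := Fin.ext (by omega)
      omega
    · simp [hs, ht]
  · unfold glue
    by_cases hs : s.1 ∈ cells nu mu <;> by_cases ht : t.1 ∈ cells nu mu
    · simpa [hs, ht] using hT.2.1 _ _ hst hle
    · simpa [hs, ht] using (lt _).le
    · obtain ⟨i, h3, h4, h5⟩ := out s hs
      obtain ⟨j, h6, h7, h8⟩ := mem_cells_iff.1 ht
      have : nu j ≤ nu i := hnu (by rw [Fin.le_def]; omega)
      omega
    · simp [hs, ht]
  · unfold glue at hp heq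
    by_cases hs' : s.1 ∈ cells nu mu <;> by_cases ht : t.1 ∈ cells nu mu
    · rw [dif_pos hs'] at hp
      rw [dif_pos hs', dif_pos ht] at heq
      have := hT.2.2.1 _ _ hst hp heq
      exact Subtype.ext (Subtype.mk.inj this)
    · rw [dif_pos hs', dif_neg ht] at heq
      exact absurd heq (lt _).ne
    · rw [dif_neg hs', dif_pos ht] at heq
      exact absurd heq (lt _).ne'
    · rw [dif_neg hs'] at hp
      obtain ⟨i, h3, h4, h5⟩ := out s hs'
      obtain ⟨j, h6, h7, h8⟩ := out t ht
      obtain rfl : i = j := Fin.ext (by omega)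
      have := hs.2.1 hp i
      exact Subtype.ext (Prod.ext hst (by omega))
  · unfold glue at hp heq
    by_cases hs' : s.1 ∈ cells nu mu <;> by_cases ht : t.1 ∈ cells nu mu
    · rw [dif_pos hs'] at hp
      rw [dif_pos hs', dif_pos ht] at heq
      have := hT.2.2.2 _ _ hst hp heq
      exact Subtype.ext (Subtype.mk.inj this)
    · rw [dif_pos hs', dif_neg ht] at heq
      exact absurd heq (lt _).ne
    · rw [dif_neg hs', dif_pos ht] at heq
      exact absurd heq (lt _).ne'
    · rw [dif_neg hs'] at hp
      obtain ⟨i, h3, h4, h5⟩ := out s hs'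
      obtain ⟨j, h6, h7, h8⟩ := out t ht
      rcases lt_trichotomy i j with h | h | h
      · have := hs.2.2 hp i j h
        omega
      · exact Subtype.ext (Prod.ext (by omega) hst)
      · have := hs.2.2 hp j i h
        omega

theorem exists_eq_glue {N : ℕ} {α : Type*} [LinearOrder α] {S : Finset (Letter α)}
    {m : Letter α} (hm : ∀ l ∈ S, l < m) {la mu : Fin N → ℤ} (hla : Antitone la)
    (hmu : Antitone mu) (h0 : 0 ≤ mu) (h1 : mu ≤ la)
    {T : cells la mu → Letter α} (hTS : ∀ s, T s ∈ insert m S) (hT : IsATableau T) :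
    ∃ nu : Fin N → ℤ, Antitone nu ∧ mu ≤ nu ∧ IsStrip m.IsPrimed la nu ∧
      ∃ T' : cells nu mu → Letter α, (∀ s, T' s ∈ S) ∧ IsATableau T' ∧ glue la m T' = T := by
  classical
  have hle : ∀ s, T s ≤ m := by
    intro s
    rcases Finset.mem_insert.1 (hTS s) with h | h
    exacts [h.le, (hm _ h).le]
  -- The new row length `f i` will be the least such column. The condition on `T` is vacuous outside
  -- the shape, so a row without `m` gets `f i = la i`.
  have hex : ∀ i : Fin N, ∃ j : ℕ, mu i ≤ j ∧
      ∀ h : ((i : ℕ), j) ∈ cells la mu, T ⟨_, h⟩ = m := by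
    intro i
    have h2 : mu i ≤ la i := h1 i
    refine ⟨(la i).toNat, by omega, fun h => ?_⟩
    rw [mk_mem_cells] at h
    omega
  choose! f hf hmin using fun i => (⟨Nat.find (hex i), Nat.find_spec (hex i),
    fun j hj => Nat.find_min (hex i) hj⟩ : ∃ k : ℕ, (mu i ≤ k ∧
      ∀ h : ((i : ℕ), k) ∈ cells la mu, T ⟨_, h⟩ = m) ∧ ∀ j < k, ¬ (mu i ≤ j ∧
      ∀ h : ((i : ℕ), j) ∈ cells la mu, T ⟨_, h⟩ = m))
  have hne : ∀ (i : Fin N) (j : ℕ) (h : ((i : ℕ), j) ∈ cells la mu), T ⟨_, h⟩ ≠ m ↔ j < f i := by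
    intro i j h
    constructor
    · intro h2
      by_contra h3
      rw [not_lt] at h3
      have h4 := mk_mem_cells.1 h
      have h5 : ((i : ℕ), f i) ∈ cells la mu := mk_mem_cells.2 ⟨(hf i).1, by omega⟩
      refine h2 (le_antisymm (hle _) ?_)
      rw [← (hf i).2 h5]
      exact hT.1 _ _ rfl h3
    · intro h2 h3
      exact hmin i j h2 ⟨(mk_mem_cells.1 h).1, fun _ => h3⟩
  have hfle : ∀ i, (f i : ℤ) ≤ la i := by
    intro i
    by_contra h2
    have h3 : mu i ≤ la i := h1 i
    have h4 : 0 ≤ mu i := h0 i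
    refine hmin i (la i).toNat (by omega) ⟨by omega, fun h => ?_⟩
    rw [mk_mem_cells] at h
    omega
  have hanti : Antitone fun i => (f i : ℤ) := by
    intro i j hij
    by_contra h2
    simp only [not_le, Nat.cast_lt] at h2
    have h3 := hmu hij
    have h4 := (hf i).1
    have h5 := hfle j
    have h6 := hla hij
    have m1 : ((i : ℕ), f i) ∈ cells la mu := mk_mem_cells.2 ⟨h4, by omega⟩
    have m2 : ((j : ℕ), f i) ∈ cells la mu := mk_mem_cells.2 ⟨by omega, by omega⟩
    refine (hne j (f i) m2).2 h2 (le_antisymm (hle _) ?_)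
    rw [← (hf i).2 m1]
    exact hT.2.1 _ _ rfl hij
  have hsub := cells_mono_left (mu := mu) hfle
  have hmem : ∀ s : cells la mu, s.1 ∈ cells (fun i => (f i : ℤ)) mu ↔ T s ≠ m := by
    rintro ⟨⟨i, j⟩, h⟩
    obtain ⟨k, h2, h3, h4⟩ := mem_cells_iff.1 h
    simp only at h2 h3 h4
    subst h2
    rw [hne k j h, mk_mem_cells]
    simp [h3]
  refine ⟨fun i => (f i : ℤ), hanti, fun i => (hf i).1, ⟨hfle, fun hp i => ?_, fun hp i j hij => ?_⟩,
    fun s => T ⟨s.1, hsub s.2⟩, fun s => ?_, ?_, ?_⟩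
  · by_contra h2
    replace h2 : ¬ la i ≤ (f i : ℤ) + 1 := h2
    have m1 : ((i : ℕ), f i) ∈ cells la mu := mk_mem_cells.2 ⟨(hf i).1, by omega⟩
    have m2 : ((i : ℕ), f i + 1) ∈ cells la mu := mk_mem_cells.2
      ⟨by have := (hf i).1; omega, by push_cast; omega⟩
    have e1 := (hf i).2 m1
    have e2 : T ⟨_, m2⟩ = m := by
      by_contra h
      have := (hne i _ m2).1 h
      omega
    have := hT.2.2.1 ⟨_, m1⟩ ⟨_, m2⟩ rfl (by rwa [e1]) (by rw [e1, e2])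
    have := congrArg (fun s : cells la mu => s.1.2) this
    simp at this
  · by_contra h2
    replace h2 : ¬ la j ≤ (f i : ℤ) := h2
    have h3 : la j ≤ la i := hla hij.le
    have h4 : mu j ≤ mu i := hmu hij.le
    have h5 := (hf i).1
    have h6 : (f j : ℤ) ≤ f i := hanti hij.le
    have m1 : ((i : ℕ), f i) ∈ cells la mu := mk_mem_cells.2 ⟨h5, by omega⟩
    have m2 : ((j : ℕ), f i) ∈ cells la mu := mk_mem_cells.2 ⟨by omega, by omega⟩
    have e1 := (hf i).2 m1
    have e2 : T ⟨_, m2⟩ = m := by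
      by_contra h
      have := (hne j _ m2).1 h
      omega
    have := hT.2.2.2 ⟨_, m1⟩ ⟨_, m2⟩ rfl (by rwa [e1]) (by rw [e1, e2])
    have := congrArg (fun s : cells la mu => s.1.1) this
    simp only at this
    exact hij.ne (Fin.ext this)
  · exact Finset.mem_of_mem_insert_of_ne (hTS _) ((hmem ⟨s.1, hsub s.2⟩).1 s.2)
  · refine ⟨fun s t h h' => hT.1 _ _ h h', fun s t h h' => hT.2.1 _ _ h h', fun s t h h' h'' => ?_,
      fun s t h h' h'' => ?_⟩
    · exact Subtype.ext (Subtype.mk.inj (hT.2.2.1 ⟨_, hsub s.2⟩ ⟨_, hsub t.2⟩ h h' h''))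
    · exact Subtype.ext (Subtype.mk.inj (hT.2.2.2 ⟨_, hsub s.2⟩ ⟨_, hsub t.2⟩ h h' h''))
  · funext s
    unfold glue
    split_ifs with h
    · rfl
    · by_contra h2
      exact h ((hmem s).2 (Ne.symm h2))

/-- If row `i` of `nu` were longer, the square in column `nu' i` would carry a letter of `S` in one
filling and `m` in the other. Used in both directions to get `nu = nu'`. -/
theorem glue_injective {N : ℕ} {α : Type*} [LinearOrder α] {S : Finset (Letter α)}
    {m : Letter α} (hm : ∀ l ∈ S, l < m) {la nu nu' mu : Fin N → ℤ} (h0 : 0 ≤ mu)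
    (h1' : mu ≤ nu') (h2 : nu ≤ la) {T : cells nu mu → Letter α}
    {T' : cells nu' mu → Letter α} (hT : ∀ s, T s ∈ S)
    (h : glue la m T = glue la m T') : nu ≤ nu' := by
  intro i
  by_contra h3
  replace h3 : ¬ nu i ≤ nu' i := h3
  have h4 : mu i ≤ nu' i := h1' i
  have h5 : 0 ≤ mu i := h0 i
  have h7 : nu i ≤ la i := h2 i
  obtain ⟨j, hj⟩ : ∃ j : ℕ, nu' i = j := Int.eq_ofNat_of_zero_le (by omega)
  have m1 : ((i : ℕ), j) ∈ cells nu mu := mk_mem_cells.2 ⟨by omega, by omega⟩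
  have m2 : ((i : ℕ), j) ∉ cells nu' mu := by
    rw [mk_mem_cells]
    omega
  have m3 : ((i : ℕ), j) ∈ cells la mu := mk_mem_cells.2 ⟨by omega, by omega⟩
  have := congrFun h ⟨_, m3⟩
  unfold glue at this
  rw [dif_pos m1, dif_neg m2] at this
  exact (hm _ (hT ⟨_, m1⟩)).ne this

open Classical in
/-- The squares with the largest letter `m` form a strip; summation over this strip. -/
theorem tableauSum_insert {N : ℕ} {α R : Type*} [LinearOrder α] [CommRing R]
    (w : Letter α → ℤ → R) {S : Finset (Letter α)} {m : Letter α} (hm : ∀ l ∈ S, l < m)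
    {la mu : Fin N → ℤ} (hla : Antitone la) (hmu : Antitone mu) (h0 : 0 ≤ mu) (h1 : mu ≤ la)
    (V : Finset (Fin N → ℤ))
    (hV : ∀ nu, mu ≤ nu → (nu ∈ V ↔ Antitone nu ∧ IsStrip m.IsPrimed la nu)) :
    tableauSum w (insert m S) la mu = ∑ nu ∈ V, if mu ≤ nu then
      (∏ i : Fin N, ∏ c ∈ Finset.Ico (nu i - i) (la i - i), w m c) * tableauSum w S nu mu
      else 0 := by
  rw [← Finset.sum_filter]
  simp only [tableauSum, Finset.mul_sum]
  rw [Finset.sum_sigma']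
  symm
  refine Finset.sum_bij (fun p _ => glue la m p.2) ?_ ?_ ?_ ?_
  · rintro ⟨nu, T⟩ h
    simp only [Finset.mem_sigma, Finset.mem_filter, Fintype.mem_piFinset] at h ⊢
    obtain ⟨⟨hnu, h2⟩, h3, h4⟩ := h
    obtain ⟨h5, h6⟩ := (hV nu h2).1 hnu
    refine ⟨fun s => ?_, isATableau_glue hm h5 h6 h3 h4⟩
    unfold glue
    split_ifs
    · exact Finset.mem_insert_of_mem (h3 _)
    · exact Finset.mem_insert_self _ _
  · rintro ⟨nu, T⟩ h ⟨nu', T'⟩ h' heq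
    simp only [Finset.mem_sigma, Finset.mem_filter, Fintype.mem_piFinset] at h h' heq
    obtain ⟨⟨hnu, h2⟩, h3, h4⟩ := h
    obtain ⟨⟨hnu', h2'⟩, h3', h4'⟩ := h'
    have h5 := ((hV nu h2).1 hnu).2.1
    have h5' := ((hV nu' h2').1 hnu').2.1
    obtain rfl : nu = nu' := le_antisymm (glue_injective hm h0 h2' h5 h3 heq)
      (glue_injective hm h0 h2 h5' h3' heq.symm)
    congr 1
    funext s
    have := congrFun heq ⟨s.1, cells_mono_left h5 s.2⟩
    unfold glue at this
    rwa [dif_pos s.2, dif_pos s.2] at this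
  · intro T h
    simp only [Finset.mem_filter, Fintype.mem_piFinset] at h
    obtain ⟨nu, h2, h3, h4, T', h5, h6, h7⟩ := exists_eq_glue hm hla hmu h0 h1 h.1 h.2
    refine ⟨⟨nu, T'⟩, ?_, h7⟩
    simp only [Finset.mem_sigma, Finset.mem_filter, Fintype.mem_piFinset]
    exact ⟨⟨(hV nu h3).2 ⟨h2, h4⟩, h3⟩, h5, h6⟩
  · rintro ⟨nu, T⟩ h
    simp only [Finset.mem_sigma, Finset.mem_filter, Fintype.mem_piFinset] at h
    exact (prod_glue w h0 h.1.2 ((hV nu h.1.2).1 h.1.1).2.1 m T).symm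


/-! ## Expansion of determinants along strips -/

/-- The minor of `Φ` with rows `la i - i` and columns `mu j - j`. -/
noncomputable def shapeDet {N : ℕ} {R : Type*} [CommRing R] (Φ : ℤ → ℤ → R)
    (la mu : Fin N → ℤ) : R :=
  Matrix.det (Matrix.of fun i j : Fin N => Φ (la i - i) (mu j - j))

/-- Multilinearity in the rows: choosing one summand in each row amounts to choosing new row lengths
`nu`. -/
theorem det_eq_sum_shapeDet {N : ℕ} {R : Type*} [CommRing R] (Φ : ℤ → ℤ → R) (mu : Fin N → ℤ)
    (A : Fin N → Finset ℤ) (e : Fin N → ℤ → R) (M : Matrix (Fin N) (Fin N) R)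
    (hM : ∀ i j, M i j = ∑ r ∈ A i, e i r * Φ (r - i) (mu j - j)) :
    M.det = ∑ nu ∈ Fintype.piFinset A, (∏ i, e i (nu i)) * shapeDet Φ nu mu := by
  have h : M = fun i => ∑ r ∈ A i, e i r • fun j : Fin N => Φ (r - i) (mu j - j) := by
    ext i j
    simp [hM]
  have h2 : M.det = Matrix.detRowAlternating.toMultilinearMap M := rfl
  rw [h2, h, MultilinearMap.map_sum_finset]
  refine Finset.sum_congr rfl fun nu _ => ?_
  rw [MultilinearMap.map_smul_univ]
  rfl

theorem antitone_of_consecutive {N : ℕ} {f : Fin N → ℤ}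
    (h : ∀ i j : Fin N, (i : ℕ) + 1 = j → f j ≤ f i) : Antitone f := by
  cases N with
  | zero => exact fun i => i.elim0
  | succ n => exact Fin.antitone_iff_succ_le.2 fun i => h _ _ (by simp)

open Classical in
/-- The shapes `nu` such that `la / nu` is a vertical strip. -/
noncomputable def verticalStrips {N : ℕ} (la : Fin N → ℤ) : Finset (Fin N → ℤ) :=
  (Fintype.piFinset fun i => Finset.Icc (la i - 1) (la i)).filter Antitone

theorem mem_verticalStrips {N : ℕ} {la nu : Fin N → ℤ} {p : Prop} (hp : p) :
    nu ∈ verticalStrips la ↔ Antitone nu ∧ IsStrip p la nu := by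
  simp only [verticalStrips, Finset.mem_filter, Fintype.mem_piFinset, Finset.mem_Icc, IsStrip]
  constructor
  · rintro ⟨h1, h2⟩
    exact ⟨h2, fun i => (h1 i).2, fun _ i => by linarith [(h1 i).1], fun h => absurd hp h⟩
  · rintro ⟨h1, h2, h3, -⟩
    exact ⟨fun i => ⟨by linarith [h3 hp i], h2 i⟩, h1⟩

/-- Each row splits in two, according to whether its last square is removed. Choices that fail to be
decreasing give a minor with two equal rows. -/
theorem shapeDet_vertical {N : ℕ} {R : Type*} [CommRing R] {Φ Ψ : ℤ → ℤ → R} (v : ℤ → R)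
    (h : ∀ l m, Ψ l m = Φ l m + v (l - 1) * Φ (l - 1) m) {la : Fin N → ℤ} (hla : Antitone la)
    (mu : Fin N → ℤ) :
    shapeDet Ψ la mu = ∑ nu ∈ verticalStrips la,
      (∏ i : Fin N, ∏ c ∈ Finset.Ico (nu i - i) (la i - i), v c) * shapeDet Φ nu mu := by
  classical
  rw [shapeDet, det_eq_sum_shapeDet Φ mu (fun i => Finset.Icc (la i - 1) (la i))
    (fun i r => ∏ c ∈ Finset.Ico (r - i) (la i - i), v c)]
  · rw [verticalStrips, Finset.sum_filter]
    refine Finset.sum_congr rfl fun nu hnu => ?_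
    split_ifs with hanti
    · rfl
    · have : ∃ i j : Fin N, (i : ℕ) + 1 = j ∧ nu i < nu j := by
        by_contra! h2
        exact hanti (antitone_of_consecutive h2)
      obtain ⟨i, j, hij, hlt⟩ := this
      have hi := Finset.mem_Icc.1 (Fintype.mem_piFinset.1 hnu i)
      have hj := Finset.mem_Icc.1 (Fintype.mem_piFinset.1 hnu j)
      have hle : la j ≤ la i := hla (by rw [Fin.le_def]; omega)
      have hne : i ≠ j := by
        rintro rfl
        omega
      -- The bounds force `la i = la j = nu j = nu i + 1` with `j = i + 1`.
      have heq : nu i - i = nu j - j := by omega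
      rw [shapeDet, Matrix.det_zero_of_row_eq hne, mul_zero]
      ext k
      simp only [Matrix.of_apply, heq]
  · intro i j
    have : Finset.Icc (la i - 1) (la i) = {la i, la i - 1} := by
      ext r
      simp only [Finset.mem_Icc, Finset.mem_insert, Finset.mem_singleton]
      omega
    rw [this, Finset.sum_pair (by omega), Matrix.of_apply, h]
    have e1 : Finset.Ico (la i - 1 - i) (la i - i) = {la i - i - 1} := by
      ext r
      simp only [Finset.mem_Ico, Finset.mem_singleton]
      omega
    rw [e1, Finset.prod_singleton, Finset.Ico_self, Finset.prod_empty, one_mul,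
      show la i - 1 - (i : ℤ) = la i - i - 1 by ring]

/-- The length of the next row of the shape `la`. -/
noncomputable def nextRow {N : ℕ} (la : Fin N → ℤ) (i : Fin N) : ℤ :=
  if h : (i : ℕ) + 1 < N then la ⟨i + 1, h⟩ else 0

/-- The shapes `nu` such that `la / nu` is a horizontal strip. -/
noncomputable def horizontalStrips {N : ℕ} (la : Fin N → ℤ) : Finset (Fin N → ℤ) :=
  Fintype.piFinset fun i => Finset.Icc (nextRow la i) (la i)

theorem mem_horizontalStrips {N : ℕ} {la nu : Fin N → ℤ} (hla : Antitone la) (h0 : 0 ≤ nu)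
    {p : Prop} (hp : ¬ p) :
    nu ∈ horizontalStrips la ↔ Antitone nu ∧ IsStrip p la nu := by
  simp only [horizontalStrips, Fintype.mem_piFinset, Finset.mem_Icc, IsStrip]
  constructor
  · intro h
    have key : ∀ i j : Fin N, i < j → la j ≤ nu i := by
      intro i j hij
      have h1 : (i : ℕ) + 1 < N := lt_of_le_of_lt hij j.2
      have h2 := (h i).1
      rw [nextRow, dif_pos h1] at h2
      refine le_trans (hla ?_) h2
      rw [Fin.le_def]
      exact hij
    refine ⟨antitone_of_consecutive fun i j hij => (h j).2.trans (key i j ?_), fun i => (h i).2,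
      fun h => absurd h hp, fun _ => key⟩
    rw [Fin.lt_def]
    omega
  · rintro ⟨-, h2, -, h3⟩ i
    refine ⟨?_, h2 i⟩
    unfold nextRow
    split_ifs with h
    · exact h3 hp _ _ (by rw [Fin.lt_def]; simp)
    · exact h0 i

/-- The recursion for `Ψ` unrolled from `l` down to `k`: subtracting a multiple of row `k` leaves
only the rows of `Φ` strictly above index `k`. -/
theorem telescope_horizontal {R : Type*} [CommRing R] {Φ Ψ : ℤ → ℤ → R} (w : ℤ → R)
    (h : ∀ l m, Ψ l m = Φ l m + w (l - 1) * Ψ (l - 1) m) (m k l : ℤ) (hkl : k ≤ l) :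
    Ψ l m - (∏ c ∈ Finset.Ico k l, w c) * Ψ k m =
      ∑ r ∈ Finset.Ioc k l, (∏ c ∈ Finset.Ico r l, w c) * Φ r m := by
  induction l, hkl using Int.leInduction with
  | base => simp
  | succ l hkl ih =>
    have e1 : ∀ r ≤ l, ∏ c ∈ Finset.Ico r (l + 1), w c = w l * ∏ c ∈ Finset.Ico r l, w c := by
      intro r hr
      have : Finset.Ico r (l + 1) = insert l (Finset.Ico r l) := by
        ext c
        simp only [Finset.mem_Ico, Finset.mem_insert]
        omega
      rw [this, Finset.prod_insert (by simp)]
    have e2 : Finset.Ioc k (l + 1) = insert (l + 1) (Finset.Ioc k l) := by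
      ext c
      simp only [Finset.mem_Ioc, Finset.mem_insert]
      omega
    rw [e2, Finset.sum_insert (by simp), Finset.Ico_self, Finset.prod_empty, one_mul, h, e1 k hkl,
      add_sub_cancel_right]
    have e3 : ∑ r ∈ Finset.Ioc k l, (∏ c ∈ Finset.Ico r (l + 1), w c) * Φ r m =
        w l * ∑ r ∈ Finset.Ioc k l, (∏ c ∈ Finset.Ico r l, w c) * Φ r m := by
      rw [Finset.mul_sum]
      refine Finset.sum_congr rfl fun r hr => ?_
      rw [e1 r (Finset.mem_Ioc.1 hr).2, mul_assoc]
    rw [e3, ← ih]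
    ring

theorem sum_Icc_sub {R : Type*} [AddCommMonoid R] (f : ℤ → R) (b l i : ℤ) :
    ∑ r ∈ Finset.Icc b l, f (r - i) = ∑ q ∈ Finset.Ioc (b - i - 1) (l - i), f q := by
  refine Finset.sum_nbij' (fun r => r - i) (fun q => q + i) ?_ ?_ ?_ ?_ ?_
  · intro r hr
    simp only [Finset.mem_Icc, Finset.mem_Ioc] at *
    omega
  · intro r hr
    simp only [Finset.mem_Icc, Finset.mem_Ioc] at *
    omega
  all_goals simp

/-- Subtracting from each row a suitable multiple of the next one, a unipotent operation `U`,
truncates the unrolled recursion exactly at the length of the next row. The surviving row choices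
are the horizontal strips, so no terms need to cancel. -/
theorem shapeDet_horizontal {N : ℕ} {R : Type*} [CommRing R] {Φ Ψ : ℤ → ℤ → R} (w : ℤ → R)
    (h : ∀ l m, Ψ l m = Φ l m + w (l - 1) * Ψ (l - 1) m) (hΨ : ∀ l m, l < m → Ψ l m = 0)
    {la mu : Fin N → ℤ} (hla : Antitone la) (h0 : 0 ≤ mu) :
    shapeDet Ψ la mu = ∑ nu ∈ horizontalStrips la,
      (∏ i : Fin N, ∏ c ∈ Finset.Ico (nu i - i) (la i - i), w c) * shapeDet Φ nu mu := by
  classical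
  set E : ℤ → ℤ → R := fun k l => ∏ c ∈ Finset.Ico k l, w c with hE
  let U : Matrix (Fin N) (Fin N) R := Matrix.of fun i k =>
    (if i = k then 1 else 0) - if (i : ℕ) + 1 = k then E (la k - k) (la i - i) else 0
  have hU : U.det = 1 := by
    rw [Matrix.det_of_isUpperTriangular]
    · refine Finset.prod_eq_one fun i _ => ?_
      simp [U]
    · intro i j hij
      have hij : j < i := hij
      have h1 : i ≠ j := hij.ne'
      have h2 : (i : ℕ) + 1 ≠ j := by
        rw [Fin.lt_def] at hij
        omega
      simp [U, h1, h2]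
  have h1 : shapeDet Ψ la mu =
      (U * Matrix.of fun i j : Fin N => Ψ (la i - i) (mu j - j)).det := by
    rw [Matrix.det_mul, hU, one_mul, shapeDet]
  rw [h1, horizontalStrips, det_eq_sum_shapeDet Φ mu (fun i => Finset.Icc (nextRow la i) (la i))
    (fun i r => ∏ c ∈ Finset.Ico (r - i) (la i - i), w c)]
  intro i j
  rw [sum_Icc_sub (fun q => (∏ c ∈ Finset.Ico q (la i - i), w c) * Φ q (mu j - j)),
    Matrix.mul_apply]
  simp only [U, Matrix.of_apply, sub_mul, ite_mul, one_mul, zero_mul, Finset.sum_sub_distrib,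
    Finset.sum_ite_eq, Finset.mem_univ, if_true]
  by_cases hi : (i : ℕ) + 1 < N
  · have e1 : ∀ k : Fin N, (i : ℕ) + 1 = k ↔ (⟨i + 1, hi⟩ : Fin N) = k := fun k => by
      rw [Fin.ext_iff]
    simp only [e1, Finset.sum_ite_eq, Finset.mem_univ, if_true]
    have hle : la ⟨i + 1, hi⟩ ≤ la i := hla (by rw [Fin.le_def]; simp)
    rw [nextRow, dif_pos hi, ← telescope_horizontal w h _ _ _ (by omega)]
    push_cast
    rw [sub_sub]
  · have e1 : ∀ k : Fin N, (i : ℕ) + 1 ≠ k := fun k => by omega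
    simp only [e1, if_false, Finset.sum_const_zero, sub_zero]
    rw [nextRow, dif_neg hi]
    have h2 : (i : ℕ) + 1 = N := by omega
    have h3 : 0 ≤ mu j := h0 j
    -- For the last row the cutoff is the index `-N`, below every column index because `mu` is
    -- nonnegative, so `Ψ` vanishes there. If `la i` is too negative, both sides are zero.
    by_cases hl : 0 - (i : ℤ) - 1 ≤ la i - i
    · rw [← telescope_horizontal w h _ _ _ hl, hΨ (0 - (i : ℤ) - 1) _ (by omega), mul_zero,
        sub_zero]
    · rw [hΨ _ _ (by omega), Finset.Ioc_eq_empty (by omega), Finset.sum_empty]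

/-- The numbers `la i - i` and `mu j - j` are strictly decreasing. At the first place where the
shapes differ, the larger of the two numbers does not occur in the other sequence, giving a zero row
or column. -/
theorem shapeDet_one {N : ℕ} {R : Type*} [CommRing R] {la mu : Fin N → ℤ}
    (hla : Antitone la) (hmu : Antitone mu) [Decidable (la = mu)] :
    shapeDet (fun l m => if l = m then (1 : R) else 0) la mu = if la = mu then 1 else 0 := by
  have strict : ∀ {f : Fin N → ℤ}, Antitone f → ∀ {i j : Fin N}, i < j → f j - j < f i - i := by
    intro f hf i j hij
    have := hf hij.le
    rw [Fin.lt_def] at hij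
    omega
  have inj : ∀ {f : Fin N → ℤ}, Antitone f → ∀ {i j : Fin N}, f i - i = f j - j → i = j := by
    intro f hf i j hij
    rcases lt_trichotomy i j with h | h | h
    · have := strict hf h
      omega
    · exact h
    · have := strict hf h
      omega
  split_ifs with h
  · subst h
    rw [shapeDet, ← Matrix.det_one (n := Fin N)]
    congr 1
    ext i j
    rw [Matrix.of_apply, Matrix.one_apply]
    by_cases hij : i = j
    · simp [hij]
    · rw [if_neg hij, if_neg fun h => hij (inj hla h)]
  · obtain ⟨k, hk, hmin⟩ : ∃ k, la k ≠ mu k ∧ ∀ j < k, la j = mu j := by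
      have hex : ∃ k, la k ≠ mu k := by
        by_contra! h2
        exact h (funext h2)
      obtain ⟨k, hk, hmin⟩ := WellFounded.has_min (wellFounded_lt (α := Fin N))
        {k | la k ≠ mu k} hex
      exact ⟨k, hk, fun j hj => by_contra fun h3 => hmin j h3 hj⟩
    rcases lt_or_gt_of_ne hk with hlt | hlt
    · refine Matrix.det_eq_zero_of_column_eq_zero k fun i => ?_
      refine if_neg fun heq => ?_
      rcases lt_trichotomy i k with h2 | h2 | h2
      · rw [hmin i h2] at heq
        exact h2.ne (inj hmu heq)
      · subst h2
        omega
      · have := strict hla h2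
        omega
    · refine Matrix.det_eq_zero_of_row_eq_zero k fun i => ?_
      refine if_neg fun heq => ?_
      rcases lt_trichotomy i k with h2 | h2 | h2
      · rw [← hmin i h2] at heq
        exact h2.ne' (inj hla heq)
      · subst h2
        omega
      · have := strict hmu h2
        omega

/-! ## Matrices representing the sums over tableaux -/

open Classical in
/-- The minors of `Φ` are the sums over the `𝔸`-tableaux with letters in `S`. -/
def Represents {α R : Type*} [LinearOrder α] [CommRing R] (w : Letter α → ℤ → R)
    (S : Finset (Letter α)) (Φ : ℤ → ℤ → R) : Prop :=
  ∀ (N : ℕ) (la mu : Fin N → ℤ), Antitone la → Antitone mu → 0 ≤ mu →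
    shapeDet Φ la mu = if mu ≤ la then tableauSum w S la mu else 0

theorem represents_empty {α R : Type*} [LinearOrder α] [CommRing R] (w : Letter α → ℤ → R) :
    Represents w ∅ fun l m => if l = m then 1 else 0 := by
  classical
  intro N la mu hla hmu h0
  rw [shapeDet_one hla hmu]
  by_cases h : la = mu
  · subst h
    rw [if_pos rfl, if_pos le_rfl, tableauSum]
    have hempty : cells la la = ∅ := by
      refine Finset.eq_empty_of_forall_notMem fun s hs => ?_
      obtain ⟨i, -, h1, h2⟩ := mem_cells_iff.1 hs
      omega
    have : IsEmpty (cells la la) := by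
      rw [hempty]
      infer_instance
    rw [Finset.filter_true_of_mem]
    · simp
    · intro T _
      exact ⟨fun s => isEmptyElim s, fun s => isEmptyElim s, fun s => isEmptyElim s,
        fun s => isEmptyElim s⟩
  · rw [if_neg h]
    split_ifs with hle
    · have : ∃ i, mu i < la i := by
        by_contra! h2
        exact h (le_antisymm h2 hle)
      obtain ⟨i, hi⟩ := this
      have h2 : 0 ≤ mu i := h0 i
      have hmem : ((i : ℕ), (mu i).toNat) ∈ cells la mu := mk_mem_cells.2 ⟨by omega, by omega⟩
      rw [tableauSum, Finset.sum_eq_zero]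
      intro T hT
      have := Fintype.mem_piFinset.1 (Finset.mem_filter.1 hT).1 ⟨_, hmem⟩
      simp at this
    · rfl

/-- The determinant and the tableau sum obey the same branching rule. The zero clause of
`Represents` disposes of the shapes `nu` that do not contain `mu`. -/
theorem Represents.insert_of_expansion {α R : Type*} [LinearOrder α] [CommRing R]
    {w : Letter α → ℤ → R} {S : Finset (Letter α)} {Φ Ψ : ℤ → ℤ → R} (hΦ : Represents w S Φ)
    {m : Letter α} (hm : ∀ l ∈ S, l < m)
    (V : ∀ {N : ℕ}, (Fin N → ℤ) → Finset (Fin N → ℤ))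
    (hV : ∀ {N : ℕ} (la nu : Fin N → ℤ), Antitone la → 0 ≤ nu →
      (nu ∈ V la ↔ Antitone nu ∧ IsStrip m.IsPrimed la nu))
    (hanti : ∀ {N : ℕ} (la nu : Fin N → ℤ), Antitone la → nu ∈ V la → Antitone nu ∧ nu ≤ la)
    (hexp : ∀ {N : ℕ} (la mu : Fin N → ℤ), Antitone la → 0 ≤ mu →
      shapeDet Ψ la mu = ∑ nu ∈ V la,
      (∏ i : Fin N, ∏ c ∈ Finset.Ico (nu i - i) (la i - i), w m c) * shapeDet Φ nu mu) :
    Represents w (insert m S) Ψ := by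
  classical
  intro N la mu hla hmu h0
  rw [hexp la mu hla h0]
  split_ifs with hle
  · rw [tableauSum_insert w hm hla hmu h0 hle (V la) fun nu hnu => hV la nu hla (h0.trans hnu)]
    refine Finset.sum_congr rfl fun nu hnu => ?_
    rw [hΦ N nu mu (hanti la nu hla hnu).1 hmu h0, mul_ite, mul_zero]
  · refine Finset.sum_eq_zero fun nu hnu => ?_
    obtain ⟨h1, h2⟩ := hanti la nu hla hnu
    rw [hΦ N nu mu h1 hmu h0, if_neg fun h => hle (h.trans h2), mul_zero]

theorem Represents.insert_primed {α R : Type*} [LinearOrder α] [CommRing R]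
    {w : Letter α → ℤ → R} {S : Finset (Letter α)} {Φ Ψ : ℤ → ℤ → R} (hΦ : Represents w S Φ)
    {m : Letter α} (hm : ∀ l ∈ S, l < m) (hp : m.IsPrimed)
    (h : ∀ l k, Ψ l k = Φ l k + w m (l - 1) * Φ (l - 1) k) : Represents w (insert m S) Ψ :=
  hΦ.insert_of_expansion hm verticalStrips (fun _ _ _ _ => mem_verticalStrips hp)
    (fun _ _ _ hnu => ⟨((mem_verticalStrips hp).1 hnu).1, ((mem_verticalStrips hp).1 hnu).2.1⟩)
    fun _ mu hla _ => shapeDet_vertical _ h hla mu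

theorem Represents.insert_unprimed {α R : Type*} [LinearOrder α] [CommRing R]
    {w : Letter α → ℤ → R} {S : Finset (Letter α)} {Φ Ψ : ℤ → ℤ → R} (hΦ : Represents w S Φ)
    {m : Letter α} (hm : ∀ l ∈ S, l < m) (hp : ¬ m.IsPrimed)
    (h : ∀ l k, Ψ l k = Φ l k + w m (l - 1) * Ψ (l - 1) k) (hΨ : ∀ l k, l < k → Ψ l k = 0) :
    Represents w (insert m S) Ψ := by
  refine hΦ.insert_of_expansion hm horizontalStrips
    (fun _ _ hla h0 => mem_horizontalStrips hla h0 hp) (fun {N} la nu hla hnu => ?_)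
    fun _ mu hla h0 => shapeDet_horizontal _ h hΨ hla h0
  have h1 : ∀ i, nextRow la i ≤ nu i ∧ nu i ≤ la i := fun i =>
    Finset.mem_Icc.1 (Fintype.mem_piFinset.1 hnu i)
  refine ⟨antitone_of_consecutive fun i j hij => ?_, fun i => (h1 i).2⟩
  have h2 := (h1 i).1
  have h3 : (i : ℕ) + 1 < N := by omega
  rw [nextRow, dif_pos h3] at h2
  rw [show (⟨i + 1, h3⟩ : Fin N) = j from Fin.ext hij] at h2
  exact (h1 j).2.trans h2


/-! ## Multiplication of the series by `(u + y) / (u - x)` -/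

/-- Multiplication by u - a_{k+1} removes the last factor of the denominator; here both sides are
multiplied by `X = 1/u`. -/
theorem invFactorial_succ_mul (a : ℤ → ℂ) (k : ℕ) :
    invFactorial a (k + 1) * (1 - PowerSeries.C (a ((k + 1 : ℕ) : ℤ)) * PowerSeries.X) =
      PowerSeries.X * invFactorial a k := by
  rw [invFactorial, invFactorial, Finset.prod_Icc_succ_top (by omega), PowerSeries.mul_inv_rev,
    pow_succ']
  have h : (1 - PowerSeries.C (a ((k + 1 : ℕ) : ℤ)) * PowerSeries.X)⁻¹ *
      (1 - PowerSeries.C (a ((k + 1 : ℕ) : ℤ)) * PowerSeries.X) = 1 :=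
    PowerSeries.inv_mul_cancel _ (by simp)
  linear_combination (PowerSeries.X * PowerSeries.X ^ k *
    (∏ i ∈ Finset.Icc 1 k, (1 - PowerSeries.C (a (i : ℤ)) * PowerSeries.X))⁻¹) * h

theorem coeff_invFactorial_succ (a : ℤ → ℂ) (n k : ℕ) :
    PowerSeries.coeff (n + 1) (invFactorial a (k + 1)) =
      a ((k + 1 : ℕ) : ℤ) * PowerSeries.coeff n (invFactorial a (k + 1)) +
        PowerSeries.coeff n (invFactorial a k) := by
  have h := congrArg (PowerSeries.coeff (n + 1)) (invFactorial_succ_mul a k)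
  rw [PowerSeries.coeff_succ_X_mul, mul_sub, mul_one, ← mul_assoc, map_sub,
    PowerSeries.coeff_succ_mul_X, PowerSeries.coeff_mul_C] at h
  linear_combination h

theorem coeff_invFactorial_of_lt (a : ℤ → ℂ) {n k : ℕ} (h : n < k) :
    PowerSeries.coeff n (invFactorial a k) = 0 := by
  rw [invFactorial, PowerSeries.coeff_X_pow_mul', if_neg (by omega)]

theorem coeff_invFactorial_zero (a : ℤ → ℂ) (n : ℕ) :
    PowerSeries.coeff n (invFactorial a 0) = if n = 0 then 1 else 0 := by
  simp [invFactorial, PowerSeries.coeff_one]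

/-- The coefficient of `X^n` in `∑_k g_k / ((u - a₁) ⋯ (u - a_k))`. -/
noncomputable def expansionCoeff {R : Type*} [CommRing R] [Algebra ℂ R] (a : ℤ → ℂ) (g : ℕ → R)
    (n : ℕ) : R :=
  ∑ k ∈ Finset.range (n + 1), algebraMap ℂ R (PowerSeries.coeff n (invFactorial a k)) * g k

/-- Multiplication of the expansion by u + z, using u = (u - a_k) + a_k in the k-th term. The term k
= 0 has no factor to absorb u; writing it uniformly introduces a spurious a_0, which is subtracted.
-/
theorem expansionCoeff_succ_add {R : Type*} [CommRing R] [Algebra ℂ R] (a : ℤ → ℂ) (g : ℕ → R)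
    (n : ℕ) (z : R) :
    expansionCoeff a g (n + 1) + z * expansionCoeff a g n =
      expansionCoeff a (fun k => g (k + 1) + (z + algebraMap ℂ R (a k)) * g k) n -
        algebraMap ℂ R (a 0 * PowerSeries.coeff n (invFactorial a 0)) * g 0 := by
  have h1 : expansionCoeff a g (n + 1) =
      (∑ k ∈ Finset.range (n + 1), algebraMap ℂ R (a ((k + 1 : ℕ) : ℤ) *
        PowerSeries.coeff n (invFactorial a (k + 1))) * g (k + 1)) +
      ∑ k ∈ Finset.range (n + 1),
        algebraMap ℂ R (PowerSeries.coeff n (invFactorial a k)) * g (k + 1) := by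
    rw [expansionCoeff, Finset.sum_range_succ', coeff_invFactorial_zero,
      if_neg (Nat.succ_ne_zero n), map_zero, zero_mul, add_zero, ← Finset.sum_add_distrib]
    refine Finset.sum_congr rfl fun k _ => ?_
    rw [coeff_invFactorial_succ, map_add, add_mul]
  have h2 : (∑ k ∈ Finset.range (n + 1), algebraMap ℂ R (a ((k + 1 : ℕ) : ℤ) *
        PowerSeries.coeff n (invFactorial a (k + 1))) * g (k + 1)) +
      algebraMap ℂ R (a 0 * PowerSeries.coeff n (invFactorial a 0)) * g 0 =
      ∑ k ∈ Finset.range (n + 1), algebraMap ℂ R (a k *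
        PowerSeries.coeff n (invFactorial a k)) * g k := by
    have h3 := Finset.sum_range_succ' (fun k : ℕ => algebraMap ℂ R (a k *
        PowerSeries.coeff n (invFactorial a k)) * g k) (n + 1)
    rw [Finset.sum_range_succ, coeff_invFactorial_of_lt a (Nat.lt_succ_self n), mul_zero, map_zero,
      zero_mul, add_zero] at h3
    rw [h3]
    rfl
  have h4 : expansionCoeff a (fun k => g (k + 1) + (z + algebraMap ℂ R (a k)) * g k) n =
      ∑ k ∈ Finset.range (n + 1),
        algebraMap ℂ R (PowerSeries.coeff n (invFactorial a k)) * g (k + 1) +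
      z * expansionCoeff a g n + ∑ k ∈ Finset.range (n + 1), algebraMap ℂ R (a k *
        PowerSeries.coeff n (invFactorial a k)) * g k := by
    rw [expansionCoeff, expansionCoeff, Finset.mul_sum, ← Finset.sum_add_distrib,
      ← Finset.sum_add_distrib]
    refine Finset.sum_congr rfl fun k _ => ?_
    rw [map_mul]
    ring
  rw [h1, h4, ← h2]
  ring

theorem expansionCoeff_hNat {R : Type*} [CommRing R] [Algebra ℂ R] (H : PowerSeries R)
    (a : ℤ → ℂ) (n : ℕ) : expansionCoeff a (hNat H a) n = PowerSeries.coeff n H :=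
  (coeff_eq_sum_hNat H a n).symm

theorem hNat_zero {R : Type*} [CommRing R] [Algebra ℂ R] (H : PowerSeries R) (a : ℤ → ℂ) :
    hNat H a 0 = PowerSeries.coeff 0 H := by
  rw [hNat]
  simp

theorem hNat_one {R : Type*} [CommRing R] [Algebra ℂ R] (a : ℤ → ℂ) (k : ℕ) :
    hNat (1 : PowerSeries R) a k = if k = 0 then 1 else 0 := by
  have h := eq_hNat (1 : PowerSeries R) a (fun k => if k = 0 then 1 else 0) fun n => by
    rw [Finset.sum_range_succ']
    simp [PowerSeries.coeff_one, coeff_invFactorial_zero, apply_ite (algebraMap ℂ R)]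
  exact (congrFun h k).symm

/-- Expand (u - x)G = (u + y)H on both sides and use uniqueness of the coefficients. The a_0
corrections cancel because the leading coefficients agree. -/
theorem hNat_succ_of_mul_eq {R : Type*} [CommRing R] [Algebra ℂ R] {G H : PowerSeries R}
    {x y : R} (h : (1 - PowerSeries.C x * PowerSeries.X) * G =
      (1 + PowerSeries.C y * PowerSeries.X) * H) (a : ℤ → ℂ) :
    hNat G a 0 = hNat H a 0 ∧ ∀ k : ℕ,
      hNat G a (k + 1) = hNat H a (k + 1) + (y + algebraMap ℂ R (a k)) * hNat H a k +
        (x - algebraMap ℂ R (a k)) * hNat G a k := by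
  have h0 : PowerSeries.coeff 0 G = PowerSeries.coeff 0 H := by
    simpa using congrArg (PowerSeries.coeff 0) h
  have hn : ∀ n, PowerSeries.coeff (n + 1) G + -x * PowerSeries.coeff n G =
      PowerSeries.coeff (n + 1) H + y * PowerSeries.coeff n H := by
    intro n
    have := congrArg (PowerSeries.coeff (n + 1)) h
    rw [sub_mul, add_mul, one_mul, one_mul, map_sub, map_add, mul_assoc, mul_assoc,
      PowerSeries.coeff_C_mul, PowerSeries.coeff_C_mul, PowerSeries.coeff_succ_X_mul,
      PowerSeries.coeff_succ_X_mul] at this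
    linear_combination this
  have hz : hNat G a 0 = hNat H a 0 := by rw [hNat_zero, hNat_zero, h0]
  refine ⟨hz, fun k => ?_⟩
  let d : ℕ → R := fun k =>
    (hNat G a (k + 1) + (-x + algebraMap ℂ R (a k)) * hNat G a k) -
      (hNat H a (k + 1) + (y + algebraMap ℂ R (a k)) * hNat H a k)
  have hd : ∀ n, expansionCoeff a d n = 0 := by
    intro n
    have e1 := expansionCoeff_succ_add a (hNat G a) n (-x)
    have e2 := expansionCoeff_succ_add a (hNat H a) n y
    rw [expansionCoeff_hNat, expansionCoeff_hNat] at e1 e2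
    have e3 : expansionCoeff a d n =
        expansionCoeff a (fun k => hNat G a (k + 1) + (-x + algebraMap ℂ R (a k)) * hNat G a k) n -
        expansionCoeff a (fun k => hNat H a (k + 1) + (y + algebraMap ℂ R (a k)) * hNat H a k) n := by
      simp only [expansionCoeff, d, mul_sub, Finset.sum_sub_distrib]
    rw [e3]
    rw [hz] at e1
    linear_combination e2 - e1 + hn n
  have hd0 : d = fun _ => 0 := by
    rw [eq_hNat 0 a d fun n => by rw [map_zero]; exact (hd n).symm]
    exact (eq_hNat 0 a (fun _ => 0) fun n => by simp).symm
  have := congrFun hd0 k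
  simp only [d] at this
  linear_combination this

/-- The coefficient `h_{l-m; τ^m a}`. -/
noncomputable def hMatrix {R : Type*} [CommRing R] [Algebra ℂ R] (H : PowerSeries R)
    (a : ℤ → ℂ) (l m : ℤ) : R :=
  hInt H (shift m a) (l - m)

theorem hMatrix_of_lt {R : Type*} [CommRing R] [Algebra ℂ R] (H : PowerSeries R)
    (a : ℤ → ℂ) {l m : ℤ} (h : l < m) : hMatrix H a l m = 0 := by
  rw [hMatrix, hInt, if_neg (by omega)]

theorem hMatrix_add {R : Type*} [CommRing R] [Algebra ℂ R] (H : PowerSeries R)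
    (a : ℤ → ℂ) (m : ℤ) (k : ℕ) : hMatrix H a (m + k) m = hNat H (shift m a) k := by
  rw [hMatrix, hInt, if_pos (by omega)]
  congr 1
  omega

theorem hMatrix_one {R : Type*} [CommRing R] [Algebra ℂ R] (a : ℤ → ℂ) :
    hMatrix (1 : PowerSeries R) a = fun l m => if l = m then 1 else 0 := by
  funext l m
  rcases lt_or_ge l m with h | h
  · rw [hMatrix_of_lt _ _ h, if_neg h.ne]
  · obtain ⟨k, rfl⟩ := Int.le.dest h
    rw [hMatrix_add, hNat_one]
    simp

/-- The shift by `m` makes (τ^m a)_{l-1-m} = a_{l-1} independent of the column, so this is a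
relation between whole rows. -/
theorem hMatrix_recursion {R : Type*} [CommRing R] [Algebra ℂ R] {G H : PowerSeries R}
    {x y : R} (h : (1 - PowerSeries.C x * PowerSeries.X) * G =
      (1 + PowerSeries.C y * PowerSeries.X) * H) (a : ℤ → ℂ) (l m : ℤ) :
    hMatrix G a l m =
      hMatrix H a l m + (y + algebraMap ℂ R (a (l - 1))) * hMatrix H a (l - 1) m +
        (x - algebraMap ℂ R (a (l - 1))) * hMatrix G a (l - 1) m := by
  obtain ⟨h0, h1⟩ := hNat_succ_of_mul_eq h (shift m a)
  rcases lt_trichotomy l m with h2 | h2 | h2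
  · simp [hMatrix_of_lt _ a h2, hMatrix_of_lt _ a (show l - 1 < m by omega)]
  · subst h2
    have e1 := hMatrix_add G a l 0
    have e2 := hMatrix_add H a l 0
    rw [Nat.cast_zero, add_zero] at e1 e2
    simp [hMatrix_of_lt _ a (show l - 1 < l by omega), e1, e2, h0]
  · obtain ⟨k, hk⟩ := Int.le.dest (show m ≤ l - 1 by omega)
    have e1 := hMatrix_add G a m (k + 1)
    have e2 := hMatrix_add H a m (k + 1)
    have e3 := hMatrix_add G a m k
    have e4 := hMatrix_add H a m k
    have hl : m + ((k + 1 : ℕ) : ℤ) = l := by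
      push_cast
      omega
    rw [hl] at e1 e2
    rw [hk] at e3 e4
    have e5 : shift m a k = a (l - 1) := by
      rw [shift, ← hk, add_comm]
    rw [e1, e2, e3, e4, h1 k, e5]

/-- The weights of the letters. -/
noncomputable def letterWeight {α R : Type*} [CommRing R] [Algebra ℂ R] (a : ℤ → ℂ) (x y : α → R)
    (l : Letter α) (c : ℤ) : R :=
  if l.IsPrimed then y l.abs + algebraMap ℂ R (a c) else x l.abs - algebraMap ℂ R (a c)

theorem represents_hMatrix {R : Type*} [CommRing R] [Algebra ℂ R] {n : ℕ} (a : ℤ → ℂ)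
    (x y : Fin n → R) (P : Fin n → PowerSeries R)
    (hP : ∀ i, (1 - PowerSeries.C (x i) * PowerSeries.X) * P i =
      1 + PowerSeries.C (y i) * PowerSeries.X) :
    Represents (letterWeight a x y) Finset.univ (hMatrix (∏ i, P i) a) := by
  classical
  have key : ∀ A : Finset (Fin n), Represents (letterWeight a x y)
      ((A ×ˢ Finset.univ).map (toLex : Fin n × Bool ≃ Letter (Fin n)).toEmbedding)
      (hMatrix (∏ i ∈ A, P i) a) := by
    intro A
    induction A using Finset.induction_on_max with
    | empty =>
      simp only [Finset.empty_product, Finset.map_empty, Finset.prod_empty, hMatrix_one]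
      exact represents_empty _
    | insert m A hm ih =>
      have hmA : m ∉ A := fun h => lt_irrefl _ (hm m h)
      have e : ((insert m A) ×ˢ (Finset.univ : Finset Bool)).map
            (toLex : Fin n × Bool ≃ Letter (Fin n)).toEmbedding =
          insert (toLex (m, true)) (insert (toLex (m, false)) ((A ×ˢ Finset.univ).map
            (toLex : Fin n × Bool ≃ Letter (Fin n)).toEmbedding)) := by
        ext l
        obtain ⟨⟨i, b⟩, rfl⟩ := toLex.surjective l
        cases b <;> simp
      have lt1 : ∀ l ∈ (A ×ˢ (Finset.univ : Finset Bool)).map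
          (toLex : Fin n × Bool ≃ Letter (Fin n)).toEmbedding, ∀ b, l < toLex (m, b) := by
        intro l hl b
        obtain ⟨⟨i, c⟩, hi, rfl⟩ := Finset.mem_map.1 hl
        exact Prod.Lex.toLex_lt_toLex.2 (Or.inl (hm i (Finset.mem_product.1 hi).1))
      rw [e]
      have h1 : (1 - PowerSeries.C (x m) * PowerSeries.X) * ∏ i ∈ insert m A, P i =
          (1 + PowerSeries.C (y m) * PowerSeries.X) * ∏ i ∈ A, P i := by
        rw [Finset.prod_insert hmA, ← mul_assoc, hP]
      -- The intermediate matrix, after m' but before m, need not be of the form `hMatrix`: only the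
      -- final one has to be triangular.
      have h2 := ih.insert_primed (m := toLex (m, false)) (fun l hl => lt1 l hl _) rfl
        (Ψ := fun l k => hMatrix (∏ i ∈ A, P i) a l k +
          (y m + algebraMap ℂ R (a (l - 1))) * hMatrix (∏ i ∈ A, P i) a (l - 1) k)
        fun l k => rfl
      refine h2.insert_unprimed (m := toLex (m, true)) ?_ (by simp [Letter.IsPrimed]) ?_ ?_
      · intro l hl
        rcases Finset.mem_insert.1 hl with rfl | hl
        · exact Prod.Lex.toLex_lt_toLex.2 (Or.inr ⟨rfl, Bool.false_lt_true⟩)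
        · exact lt1 l hl _
      · intro l k
        exact hMatrix_recursion h1 a l k
      · intro l k hlk
        exact hMatrix_of_lt _ a hlk
  have h := key Finset.univ
  rwa [Finset.univ_product_univ, Finset.map_univ_equiv] at h

/-! ## The skew formula -/

theorem ordConnected_skewCells (la mu : YoungDiagram) :
    ((skewCells la mu : Finset (ℕ × ℕ)) : Set (ℕ × ℕ)).OrdConnected := by
  refine ⟨fun p hp r hr q hq => ?_⟩
  simp only [skewCells, Finset.mem_coe, Finset.mem_sdiff, YoungDiagram.mem_cells] at *
  exact ⟨la.isLowerSet hq.2 hr.1, fun h => hp.2 (mu.isLowerSet hq.1 h)⟩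

theorem skewCells_eq_cells {la mu : YoungDiagram} {N : ℕ} (hN : la.colLen 0 ≤ N) :
    skewCells la mu = cells (fun i : Fin N => (la.rowLen i : ℤ)) fun i => (mu.rowLen i : ℤ) := by
  ext ⟨i, j⟩
  simp only [skewCells, Finset.mem_sdiff, YoungDiagram.mem_cells]
  rw [YoungDiagram.mem_iff_lt_rowLen, YoungDiagram.mem_iff_lt_rowLen, mem_cells_iff]
  constructor
  · rintro ⟨h1, h2⟩
    have h3 : (i, 0) ∈ la := la.up_left_mem le_rfl (Nat.zero_le j)
      (YoungDiagram.mem_iff_lt_rowLen.2 h1)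
    have h4 := YoungDiagram.mem_iff_lt_colLen.1 h3
    exact ⟨⟨i, by omega⟩, rfl, by simpa using h2, by simpa using h1⟩
  · rintro ⟨k, rfl, h1, h2⟩
    exact ⟨by simpa using h2, by simpa using h1⟩

theorem aSum_eq_tableauSum {R : Type*} [CommRing R] [Algebra ℂ R] {n N : ℕ} (a : ℤ → ℂ)
    (la mu : Fin N → ℤ) (x y : Fin n → R) :
    aSum a (cells la mu) x y = tableauSum (letterWeight a x y) Finset.univ la mu := by
  classical
  rw [aSum, tableauSum, Fintype.piFinset_univ, Finset.sum_filter, Finset.sum_filter]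
  refine Fintype.sum_equiv (Equiv.piCongrRight fun _ => toLex) _ _ fun T => ?_
  refine if_congr Iff.rfl ?_ rfl
  rw [aWeight, mul_comm, Finset.prod_filter, Finset.prod_filter, ← Finset.prod_mul_distrib]
  refine Finset.prod_congr rfl fun s _ => ?_
  simp only [letterWeight, Equiv.piCongrRight_apply, Pi.map_apply]
  split_ifs <;> simp

/-- The shift `mu_j - j` in the determinant is its column index, so the determinant is a minor of
`hMatrix`. -/
theorem skewSchurFin_eq_aSum (a : ℤ → ℂ) {la mu : YoungDiagram} (hle : mu ≤ la) (n : ℕ) {N : ℕ}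
    (hN : la.colLen 0 ≤ N) :
    skewSchurFin a la mu n N = aSum a (skewCells la mu) (xFin n) (yFin n) := by
  have hP : ∀ i : Fin n, (1 - PowerSeries.C (xFin n i) * PowerSeries.X) *
      ((1 + PowerSeries.C (MvPolynomial.X (Sum.inr i)) * PowerSeries.X) *
      PowerSeries.invOfUnit (1 - PowerSeries.C (MvPolynomial.X (Sum.inl i)) * PowerSeries.X) 1) =
      1 + PowerSeries.C (yFin n i) * PowerSeries.X := by
    intro i
    have := PowerSeries.mul_invOfUnit (1 - PowerSeries.C (xFin n i) * PowerSeries.X) 1 (by simp)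
    rw [mul_left_comm]
    change _ * (_ * PowerSeries.invOfUnit (1 - PowerSeries.C (xFin n i) * PowerSeries.X) 1) = _
    rw [this, mul_one]
    rfl
  have h := represents_hMatrix a (xFin n) (yFin n) _ hP N (fun i => (la.rowLen i : ℤ))
    (fun i => (mu.rowLen i : ℤ)) (fun i j hij => by simpa using la.rowLen_anti i j hij)
    (fun i j hij => by simpa using mu.rowLen_anti i j hij) (fun i => by simp)
  have hle' : (fun i : Fin N => (mu.rowLen i : ℤ)) ≤ fun i : Fin N => (la.rowLen i : ℤ) := by
    intro i
    simp only [Nat.cast_le]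
    by_contra h2
    have h3 : ((i : ℕ), la.rowLen i) ∈ mu := YoungDiagram.mem_iff_lt_rowLen.2 (not_le.1 h2)
    exact lt_irrefl _ (YoungDiagram.mem_iff_lt_rowLen.1 (hle h3))
  rw [if_pos hle', ← aSum_eq_tableauSum, ← skewCells_eq_cells hN] at h
  rw [← h, skewSchurFin, shapeDet]
  congr 1
  ext1 i j
  rw [Matrix.of_apply, Matrix.of_apply, hMatrix, completeSeriesFin]
  congr 1
  ring

theorem skewSchurFin_eq_diagonalSum (a : ℤ → ℂ) {la mu : YoungDiagram} (hle : mu ≤ la) (n : ℕ)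
    {N : ℕ} (hN : la.colLen 0 ≤ N) :
    skewSchurFin a la mu n N = diagonalSum a (skewCells la mu) (xFin n) (yFin n) := by
  rw [skewSchurFin_eq_aSum a hle n hN, aSum_eq_diagonalSum a (ordConnected_skewCells la mu)]


/-! ## The super realization in finitely many variables -/

theorem constantCoeff_powerSumSeries : PowerSeries.constantCoeff powerSumSeries = 0 := by
  rw [← PowerSeries.coeff_zero_eq_constantCoeff_apply, powerSumSeries, PowerSeries.coeff_mk]
  simp

theorem derivative_completeSeries :
    PowerSeries.derivative SymmFun completeSeries =
      completeSeries * PowerSeries.derivative SymmFun powerSumSeries := by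
  rw [completeSeries, PowerSeries.derivative_subst
    (PowerSeries.HasSubst.of_constantCoeff_zero' constantCoeff_powerSumSeries),
    PowerSeries.derivative_exp]

theorem constantCoeff_completeSeries : PowerSeries.constantCoeff completeSeries = 1 := by
  have hs := PowerSeries.HasSubst.of_constantCoeff_zero' constantCoeff_powerSumSeries
  have h : completeSeries = (PowerSeries.exp SymmFun - 1).subst powerSumSeries + 1 := by
    have h1 : (1 : PowerSeries SymmFun).subst powerSumSeries = (1 : PowerSeries SymmFun) := by
      rw [← PowerSeries.coe_substAlgHom hs, map_one]
    conv_lhs => rw [completeSeries, ← sub_add_cancel (PowerSeries.exp SymmFun) 1,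
      PowerSeries.subst_add hs, h1]
  have h2 : PowerSeries.constantCoeff ((PowerSeries.exp SymmFun - 1).subst powerSumSeries) = 0 :=
    PowerSeries.constantCoeff_subst_eq_zero constantCoeff_powerSumSeries _ (by simp)
  rw [h, map_add, h2, zero_add, map_one]

/-- The equation determines n + 1 times the coefficient of `X^(n+1)` from the lower ones. -/
theorem eq_of_derivative_eq_mul {R : Type*} [CommRing R] [IsDomain R] [CharZero R]
    {F G Q : PowerSeries R} (hF : PowerSeries.derivative R F = F * Q)
    (hG : PowerSeries.derivative R G = G * Q)
    (h0 : PowerSeries.constantCoeff F = PowerSeries.constantCoeff G) : F = G := by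
  ext n
  induction n using Nat.strong_induction_on with
  | _ n ih =>
    cases n with
    | zero => simpa using h0
    | succ n =>
      have h1 := congrArg (PowerSeries.coeff n) hF
      have h2 := congrArg (PowerSeries.coeff n) hG
      rw [PowerSeries.coeff_derivative, PowerSeries.coeff_mul] at h1 h2
      have h3 : ∑ p ∈ Finset.HasAntidiagonal.antidiagonal n, PowerSeries.coeff p.1 F * PowerSeries.coeff p.2 Q =
          ∑ p ∈ Finset.HasAntidiagonal.antidiagonal n, PowerSeries.coeff p.1 G * PowerSeries.coeff p.2 Q := by
        refine Finset.sum_congr rfl fun p hp => ?_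
        rw [ih p.1 (by have := Finset.HasAntidiagonal.mem_antidiagonal.1 hp; omega)]
      rw [h3, ← h2] at h1
      exact mul_right_cancel₀ (Nat.cast_add_one_ne_zero n) h1

theorem derivative_map {R S : Type*} [CommRing R] [CommRing S] (f : R →+* S) (F : PowerSeries R) :
    PowerSeries.derivative S (PowerSeries.map f F) =
      PowerSeries.map f (PowerSeries.derivative R F) := by
  ext n
  simp [PowerSeries.coeff_derivative]

theorem derivative_prod_eq_mul {ι R : Type*} [CommRing R] (s : Finset ι)
    (F q : ι → PowerSeries R) (h : ∀ i ∈ s, PowerSeries.derivative R (F i) = F i * q i) :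
    PowerSeries.derivative R (∏ i ∈ s, F i) = (∏ i ∈ s, F i) * ∑ i ∈ s, q i := by
  classical
  induction s using Finset.induction_on with
  | empty => simp
  | insert i s hi ih =>
    rw [Finset.prod_insert hi, Finset.sum_insert hi, Derivation.leibniz,
      ih fun j hj => h j (Finset.mem_insert_of_mem hj), h i (Finset.mem_insert_self _ _)]
    simp only [smul_eq_mul]
    ring

/-- The logarithmic derivative of `(1 + y X) / (1 - x X)`. -/
theorem derivative_eq_mul_of_mul_eq {R : Type*} [CommRing R] [IsDomain R] {x y : R}
    {F : PowerSeries R} (h : (1 - PowerSeries.C x * PowerSeries.X) * F =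
      1 + PowerSeries.C y * PowerSeries.X) :
    PowerSeries.derivative R F =
      F * PowerSeries.mk fun k => x ^ (k + 1) + (-1) ^ k * y ^ (k + 1) := by
  set X : PowerSeries R := PowerSeries.X
  set q : PowerSeries R := PowerSeries.mk fun k => x ^ (k + 1) + (-1) ^ k * y ^ (k + 1)
  have hx : (1 - PowerSeries.C x * X) * (PowerSeries.mk fun k => x ^ (k + 1)) =
      PowerSeries.C x := by
    ext n
    rw [sub_mul, one_mul, mul_assoc, map_sub, PowerSeries.coeff_C_mul]
    cases n with
    | zero => simp [X]
    | succ n =>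
      rw [PowerSeries.coeff_succ_X_mul, PowerSeries.coeff_mk, PowerSeries.coeff_mk,
        PowerSeries.coeff_C, if_neg (Nat.succ_ne_zero n)]
      ring
  have hy : (1 + PowerSeries.C y * X) * (PowerSeries.mk fun k => (-1) ^ k * y ^ (k + 1)) =
      PowerSeries.C y := by
    ext n
    rw [add_mul, one_mul, mul_assoc, map_add, PowerSeries.coeff_C_mul]
    cases n with
    | zero => simp [X]
    | succ n =>
      rw [PowerSeries.coeff_succ_X_mul, PowerSeries.coeff_mk, PowerSeries.coeff_mk,
        PowerSeries.coeff_C, if_neg (Nat.succ_ne_zero n)]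
      ring
  have hq : q = (PowerSeries.mk fun k => x ^ (k + 1)) +
      PowerSeries.mk fun k => (-1) ^ k * y ^ (k + 1) := by
    ext n
    simp [q]
  have hD := congrArg (PowerSeries.derivative R) h
  have hc : ∀ z : R, PowerSeries.derivative R (PowerSeries.C z * X) = PowerSeries.C z := by
    intro z
    rw [Derivation.leibniz, PowerSeries.derivative_C, PowerSeries.derivative_X]
    simp
  rw [Derivation.leibniz, map_sub, map_add, hc, hc, Derivation.map_one_eq_zero] at hD
  simp only [smul_eq_mul] at hD
  have n1 : (1 - PowerSeries.C x * X) ≠ 0 := fun h0 => by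
    have := congrArg PowerSeries.constantCoeff h0
    simp [X] at this
  have n2 : (1 + PowerSeries.C y * X) ≠ 0 := fun h0 => by
    have := congrArg PowerSeries.constantCoeff h0
    simp [X] at this
  -- Clearing both denominators turns the claim into a linear combination of `hD`, `hx`, `hy` and
  -- `h`.
  refine mul_left_cancel₀ (mul_ne_zero n1 n2) ?_
  rw [hq]
  linear_combination (1 + PowerSeries.C y * X) * hD - F * (1 + PowerSeries.C y * X) * hx -
    F * (1 - PowerSeries.C x * X) * hy - PowerSeries.C y * h

theorem coeff_derivative_powerSumSeries (k : ℕ) :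
    PowerSeries.coeff k (PowerSeries.derivative SymmFun powerSumSeries) =
      MvPolynomial.X k.succPNat := by
  have h1 : (MvPolynomial.C (((k + 1 : ℕ) : ℂ)⁻¹) : SymmFun) * ((k : SymmFun) + 1) = 1 := by
    rw [show ((k : SymmFun) + 1) = MvPolynomial.C ((k + 1 : ℕ) : ℂ) by simp, ← MvPolynomial.C_mul,
      inv_mul_cancel₀ (by exact_mod_cast Nat.succ_ne_zero k), MvPolynomial.C_1]
  have h2 : (MvPolynomial.C (((k + 1 : ℕ) : ℂ)⁻¹) * MvPolynomial.X k.succPNat :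
      SymmFun) * ((k : SymmFun) + 1) = MvPolynomial.X k.succPNat := by
    rw [mul_right_comm, h1, one_mul]
  rw [PowerSeries.coeff_derivative, powerSumSeries, PowerSeries.coeff_mk,
    dif_pos (Nat.succ_pos k)]
  exact h2

/-- Both series solve F' = F·Q with constant term 1, where the coefficients of `Q` are the super
power sums; this avoids evaluating the exponential. -/
theorem map_completeSeries (n : ℕ) :
    PowerSeries.map (superFin n).toRingHom completeSeries = completeSeriesFin n := by
  set Q : PowerSeries (MvPolynomial (Fin n ⊕ Fin n) ℂ) :=
    ∑ i : Fin n, PowerSeries.mk fun k => xFin n i ^ (k + 1) + (-1) ^ k * yFin n i ^ (k + 1) with hQ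
  refine eq_of_derivative_eq_mul (Q := Q) ?_ ?_ ?_
  · rw [derivative_map, derivative_completeSeries, map_mul]
    congr 1
    ext1 k
    rw [PowerSeries.coeff_map, coeff_derivative_powerSumSeries, hQ, map_sum]
    simp only [PowerSeries.coeff_mk]
    rw [Finset.sum_add_distrib, ← Finset.mul_sum]
    change superFin n _ = _
    rw [superFin, MvPolynomial.aeval_X]
    rfl
  · rw [completeSeriesFin, derivative_prod_eq_mul]
    intro i _
    refine derivative_eq_mul_of_mul_eq ?_
    rw [mul_left_comm, xFin, PowerSeries.mul_invOfUnit _ _ (by simp), mul_one, yFin]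
  · rw [← PowerSeries.coeff_zero_eq_constantCoeff_apply, PowerSeries.coeff_map,
      PowerSeries.coeff_zero_eq_constantCoeff_apply, constantCoeff_completeSeries, map_one,
      completeSeriesFin, map_prod]
    symm
    refine Finset.prod_eq_one fun i _ => ?_
    simp [PowerSeries.constantCoeff_invOfUnit]

/-- The images satisfy the equations that characterize the coefficients of the image series. -/
theorem map_hInt {R S : Type*} [CommRing R] [Algebra ℂ R] [CommRing S] [Algebra ℂ S]
    (f : R →ₐ[ℂ] S) (H : PowerSeries R) (a : ℤ → ℂ) (k : ℤ) :
    f (hInt H a k) = hInt (PowerSeries.map f.toRingHom H) a k := by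
  have h := eq_hNat (PowerSeries.map f.toRingHom H) a (fun k => f (hNat H a k)) fun n => by
    rw [PowerSeries.coeff_map, coeff_eq_sum_hNat H a n, map_sum]
    refine Finset.sum_congr rfl fun k _ => ?_
    rw [map_mul]
    congr 1
    exact f.commutes _
  rw [hInt, hInt, apply_ite f, map_zero]
  exact if_congr Iff.rfl (congrFun h _) rfl

theorem rowLen_bot (i : ℕ) : (⊥ : YoungDiagram).rowLen i = 0 := by
  by_contra h
  exact YoungDiagram.notMem_bot _ (YoungDiagram.mem_iff_lt_rowLen.2 (Nat.pos_of_ne_zero h))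

theorem skewCells_bot (mu : YoungDiagram) : skewCells mu ⊥ = mu.cells := by
  simp [skewCells]

theorem superFin_schur (a : ℤ → ℂ) (mu : YoungDiagram) (n N : ℕ) :
    superFin n (schur a mu N) = skewSchurFin a mu ⊥ n N := by
  rw [schur, skewSchurFin, AlgHom.map_det]
  congr 1
  ext1 i j
  rw [AlgHom.mapMatrix_apply, Matrix.map_apply, Matrix.of_apply, Matrix.of_apply, map_hInt,
    map_completeSeries, rowLen_bot]
  congr 1
  · simp
  · push_cast
    ring

theorem superFin_schur_eq_diagonalSum (a : ℤ → ℂ) {mu : YoungDiagram} (n : ℕ) {N : ℕ}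
    (hN : mu.colLen 0 ≤ N) :
    superFin n (schur a mu N) = diagonalSum a mu.cells (xFin n) (yFin n) := by
  rw [superFin_schur, skewSchurFin_eq_diagonalSum a bot_le n hN, skewCells_bot]

/-! ## Infinitely many variables -/

/-- The inclusion of the variables with index less than `n`. -/
def variableEmb (n : ℕ) : Fin n ⊕ Fin n ↪ ℕ ⊕ ℕ :=
  Function.Embedding.sumMap Fin.valEmbedding Fin.valEmbedding

/-- Put the variables with index at least `n` equal to zero. -/
noncomputable def restrictVars (n : ℕ) :
    MvPowerSeries (ℕ ⊕ ℕ) ℂ →ₐ[ℂ] MvPowerSeries (Fin n ⊕ Fin n) ℂ :=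
  MvPowerSeries.killCompl (variableEmb n)

theorem restrictVars_xInf_of_le {n i : ℕ} (h : n ≤ i) : restrictVars n (xInf i) = 0 := by
  refine MvPowerSeries.killCompl_X_eq_zero ?_
  rintro ⟨j | j, hj⟩
  · have : (j : ℕ) = i := Sum.inl.inj hj
    omega
  · cases hj

theorem restrictVars_yInf_of_le {n i : ℕ} (h : n ≤ i) : restrictVars n (yInf i) = 0 := by
  refine MvPowerSeries.killCompl_X_eq_zero ?_
  rintro ⟨j | j, hj⟩
  · cases hj
  · have : (j : ℕ) = i := Sum.inr.inj hj
    omega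

theorem restrictVars_xInf {n : ℕ} (i : Fin n) : restrictVars n (xInf i) = xFin n i := by
  rw [xFin, MvPolynomial.coe_X]
  exact MvPowerSeries.killCompl_X (e := variableEmb n) (Sum.inl i)

theorem restrictVars_yInf {n : ℕ} (i : Fin n) : restrictVars n (yInf i) = yFin n i := by
  rw [yFin, MvPolynomial.coe_X]
  exact MvPowerSeries.killCompl_X (e := variableEmb n) (Sum.inr i)

theorem coeff_restrictVars {n : ℕ} (m : Fin n ⊕ Fin n →₀ ℕ) (F : MvPowerSeries (ℕ ⊕ ℕ) ℂ) :
    MvPowerSeries.coeff m (restrictVars n F) =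
      MvPowerSeries.coeff (m.embDomain (variableEmb n)) F :=
  MvPowerSeries.coeff_killCompl F m

/-- The infinite sum is defined coefficientwise, so coefficients are compared; the terms with index
at least `n` die because `k` is positive. -/
theorem restrictVars_superPowerSum (n : ℕ) (k : ℕ+) :
    restrictVars n (superPowerSum k) =
      ((∑ i, xFin n i ^ (k : ℕ) + (-1) ^ ((k : ℕ) - 1) * ∑ i, yFin n i ^ (k : ℕ) :
        MvPolynomial (Fin n ⊕ Fin n) ℂ) : MvPowerSeries (Fin n ⊕ Fin n) ℂ) := by
  ext m
  rw [coeff_restrictVars]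
  have h : ∀ i : ℕ, MvPowerSeries.coeff (m.embDomain (variableEmb n))
      (xInf i ^ (k : ℕ) + (-1) ^ ((k : ℕ) - 1) * yInf i ^ (k : ℕ)) =
      MvPowerSeries.coeff m (restrictVars n (xInf i) ^ (k : ℕ) +
        (-1) ^ ((k : ℕ) - 1) * restrictVars n (yInf i) ^ (k : ℕ)) := by
    intro i
    rw [← coeff_restrictVars]
    simp only [map_add, map_mul, map_pow, map_neg, map_one]
  have h2 : MvPowerSeries.coeff (m.embDomain (variableEmb n)) (superPowerSum k) =
      ∑ᶠ i : ℕ, MvPowerSeries.coeff (m.embDomain (variableEmb n))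
        (xInf i ^ (k : ℕ) + (-1) ^ ((k : ℕ) - 1) * yInf i ^ (k : ℕ)) := rfl
  rw [h2, finsum_congr h, finsum_eq_sum_of_support_subset (s := Finset.range n), Finset.sum_range]
  · simp only [restrictVars_xInf, restrictVars_yInf]
    rw [← map_sum, Finset.sum_add_distrib, ← Finset.mul_sum]
    congr 1
    simp only [← MvPolynomial.coeToMvPowerSeries.ringHom_apply, map_add, map_mul, map_sum, map_pow,
      map_neg, map_one]
  · intro i hi
    by_contra h3
    have h4 : n ≤ i := by simpa using h3
    refine hi ?_
    simp only [restrictVars_xInf_of_le h4, restrictVars_yInf_of_le h4]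
    rw [zero_pow k.ne_zero]
    simp

theorem restrictVars_superInf (n : ℕ) (f : SymmFun) :
    restrictVars n (superInf f) = (superFin n f : MvPowerSeries (Fin n ⊕ Fin n) ℂ) := by
  have h : (restrictVars n).comp superInf =
      (MvPolynomial.coeToMvPowerSeries.algHom ℂ).comp (superFin n) := by
    refine MvPolynomial.algHom_ext fun k => ?_
    rw [AlgHom.comp_apply, AlgHom.comp_apply, superInf, superFin, MvPolynomial.aeval_X,
      MvPolynomial.aeval_X, restrictVars_superPowerSum, MvPolynomial.coeToMvPowerSeries.algHom_apply]
    simp [xFin, yFin]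
  have h2 := DFunLike.congr_fun h f
  rw [AlgHom.comp_apply, AlgHom.comp_apply, MvPolynomial.coeToMvPowerSeries.algHom_apply] at h2
  simpa using h2

theorem map_fWeight {R S : Type*} [CommRing R] [Algebra ℂ R] [CommRing S] [Algebra ℂ S]
    (f : R →ₐ[ℂ] S) (a : ℤ → ℂ) (nu : Finset (ℕ × ℕ)) (u v : R) :
    f (fWeight a nu u v) = fWeight a nu (f u) (f v) := by
  simp [fWeight, hookWeight, map_prod]

theorem map_diagonalWeight {α R S : Type*} [LinearOrder α] [CommRing R] [Algebra ℂ R] [CommRing S]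
    [Algebra ℂ S] (f : R →ₐ[ℂ] S) (a : ℤ → ℂ) (x y : α → R) {nu : Finset (ℕ × ℕ)} (T : nu → α) :
    f (diagonalWeight a x y T) = diagonalWeight a (fun i => f (x i)) (fun i => f (y i)) T := by
  simp [diagonalWeight, map_prod, map_fWeight]

/-- The factor `u + v` of any component vanishes. This is why a tableau with an entry `≥ n`
disappears under `restrictVars n`. -/
theorem fWeight_zero_zero {R : Type*} [CommRing R] [Algebra ℂ R] (a : ℤ → ℂ)
    {nu : Finset (ℕ × ℕ)} {s : ℕ × ℕ} (hs : s ∈ nu) : fWeight a nu (0 : R) 0 = 0 := by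
  rw [fWeight]
  refine Finset.prod_eq_zero (Finset.mem_image_of_mem _ hs) ?_
  simp [hookWeight]

theorem diagonalWeight_val {R : Type*} [CommRing R] [Algebra ℂ R] {n : ℕ} (a : ℤ → ℂ)
    (x y : ℕ → R) {nu : Finset (ℕ × ℕ)} (T : nu → Fin n) :
    diagonalWeight a x y (fun s => (T s : ℕ)) =
      diagonalWeight a (fun i : Fin n => x i) (fun i : Fin n => y i) T := by
  classical
  have h : Finset.univ.image (fun s => (T s : ℕ)) =
      (Finset.univ.image T).map Fin.valEmbedding := by
    ext i
    simp
  rw [diagonalWeight, h, Finset.prod_map, diagonalWeight]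
  refine Finset.prod_congr rfl fun i _ => ?_
  have h2 : preimage (fun s => (T s : ℕ)) (Fin.valEmbedding i) = preimage T i := by
    ext s
    simp only [mem_preimage, Fin.valEmbedding_apply, Fin.val_inj]
  rw [h2]
  rfl

theorem restrictVars_diagonalWeight {n : ℕ} (a : ℤ → ℂ) {nu : Finset (ℕ × ℕ)} (T : nu → Fin n) :
    restrictVars n (diagonalWeight a xInf yInf fun s => (T s : ℕ)) =
      (diagonalWeight a (xFin n) (yFin n) T : MvPolynomial (Fin n ⊕ Fin n) ℂ) := by
  rw [diagonalWeight_val, map_diagonalWeight]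
  have h := map_diagonalWeight (MvPolynomial.coeToMvPowerSeries.algHom ℂ) a (xFin n) (yFin n) T
  simp only [MvPolynomial.coeToMvPowerSeries.algHom_apply, Algebra.algebraMap_self,
    MvPowerSeries.map_id, RingHom.id_apply] at h
  simp only [restrictVars_xInf, restrictVars_yInf]
  exact h.symm

theorem restrictVars_diagonalWeight_eq_zero {n : ℕ} (a : ℤ → ℂ) {nu : Finset (ℕ × ℕ)}
    {T : nu → ℕ} {s : nu} (hs : n ≤ T s) :
    restrictVars n (diagonalWeight a xInf yInf T) = 0 := by
  rw [map_diagonalWeight, diagonalWeight]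
  refine Finset.prod_eq_zero (Finset.mem_image_of_mem T (Finset.mem_univ s)) ?_
  rw [restrictVars_xInf_of_le hs, restrictVars_yInf_of_le hs]
  exact fWeight_zero_zero a (mem_preimage.2 ⟨s.2, rfl⟩)

theorem exists_eq_embDomain (m : ℕ ⊕ ℕ →₀ ℕ) :
    ∃ (n : ℕ) (m' : Fin n ⊕ Fin n →₀ ℕ), m = m'.embDomain (variableEmb n) := by
  let size : ℕ ⊕ ℕ → ℕ := Sum.elim id id
  refine ⟨m.support.sup size + 1, ?_⟩
  have h : m ∈ Set.range (Finsupp.embDomain (M := ℕ) (variableEmb (m.support.sup size + 1))) := by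
    rw [Finsupp.mem_range_embDomain_iff]
    intro i hi
    have h2 : size i < m.support.sup size + 1 := Nat.lt_succ_of_le (Finset.le_sup hi)
    rcases i with i | i
    · exact ⟨Sum.inl ⟨i, h2⟩, rfl⟩
    · exact ⟨Sum.inr ⟨i, h2⟩, rfl⟩
  obtain ⟨m', h⟩ := h
  exact ⟨m', h.symm⟩

theorem isFormalSum_diagonalWeight (a : ℤ → ℂ) {mu : YoungDiagram} {N : ℕ}
    (hN : mu.colLen 0 ≤ N) :
    IsFormalSum
      (fun T : {T : mu.cells → ℕ // IsDiagonalStrict T} => diagonalWeight a xInf yInf T.1)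
      (superInf (schur a mu N)) := by
  classical
  intro m
  obtain ⟨n, m, rfl⟩ := exists_eq_embDomain m
  simp only [← coeff_restrictVars]
  -- Only tableaux with entries below `n` contribute to this monomial; `g` embeds this finite set,
  -- which reduces both assertions to `n + n` variables.
  let g : {T : mu.cells → Fin n // IsDiagonalStrict T} →
      {T : mu.cells → ℕ // IsDiagonalStrict T} := fun T => ⟨fun s => (T.1 s : ℕ), T.2⟩
  have hg : Function.Injective g := by
    intro T T' h
    refine Subtype.ext (funext fun s => Fin.ext ?_)
    exact congrFun (congrArg Subtype.val h) s
  have hzero : ∀ T : {T : mu.cells → ℕ // IsDiagonalStrict T}, T ∉ Set.range g →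
      MvPowerSeries.coeff m (restrictVars n (diagonalWeight a xInf yInf T.1)) = 0 := by
    intro T hT
    have : ∃ s, n ≤ T.1 s := by
      by_contra! h
      exact hT ⟨⟨fun s => ⟨T.1 s, h s⟩, T.2⟩, rfl⟩
    obtain ⟨s, hs⟩ := this
    rw [restrictVars_diagonalWeight_eq_zero a hs, map_zero]
  constructor
  · refine (Set.finite_range g).subset fun T hT => ?_
    by_contra h
    exact hT (hzero T h)
  · have h1 : ∀ T : {T : mu.cells → ℕ // IsDiagonalStrict T},
        MvPowerSeries.coeff m (restrictVars n (diagonalWeight a xInf yInf T.1)) =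
        ∑ᶠ _ : T ∈ Set.range g,
          MvPowerSeries.coeff m (restrictVars n (diagonalWeight a xInf yInf T.1)) := by
      intro T
      by_cases h : T ∈ Set.range g
      · rw [finsum_eq_if, if_pos h]
      · rw [finsum_eq_if, if_neg h, hzero T h]
    rw [finsum_congr h1, finsum_mem_range hg, finsum_eq_sum_of_fintype, restrictVars_superInf,
      superFin_schur_eq_diagonalSum a n hN, diagonalSum]
    have h2 : ∀ T : {T : mu.cells → Fin n // IsDiagonalStrict T},
        MvPowerSeries.coeff m (restrictVars n (diagonalWeight a xInf yInf (g T).1)) =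
        MvPolynomial.coeff m (diagonalWeight a (xFin n) (yFin n) T.1) := by
      intro T
      rw [restrictVars_diagonalWeight, MvPolynomial.coeff_coe]
    rw [Finset.sum_congr rfl fun T _ => h2 T, MvPolynomial.coeff_coe, MvPolynomial.coeff_sum]
    exact Finset.sum_subtype _ (by simp)
      fun T => MvPolynomial.coeff m (diagonalWeight a (xFin n) (yFin n) T)

end MultiSchur

theorem theorem4p6 (a : ℤ → ℂ) :
    -- the multiparameter Schur functions, for every admissible order of the determinant
    (∀ (mu : YoungDiagram) (N : ℕ), mu.colLen 0 ≤ N →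
      -- in infinitely many variables, over diagonal-strict tableaux
      IsFormalSum
        (fun T : {T : mu.cells → ℕ // IsDiagonalStrict T} => diagonalWeight a xInf yInf T.1)
        (superInf (schur a mu N)) ∧
      -- in infinitely many variables, over primed and unprimed tableaux
      IsFormalSum
        (fun T : {T : mu.cells → ℕ // IsDiagonalStrict T} => aSumOver a xInf yInf T.1)
        (superInf (schur a mu N)) ∧
      -- in `n + n` variables
      ∀ n : ℕ,
        superFin n (schur a mu N) = diagonalSum a mu.cells (xFin n) (yFin n) ∧
        superFin n (schur a mu N) = aSum a mu.cells (xFin n) (yFin n)) ∧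
    -- the skew version in `n + n` variables
    (∀ (la mu : YoungDiagram), mu ≤ la → ∀ n N : ℕ, la.colLen 0 ≤ N →
      skewSchurFin a la mu n N = diagonalSum a (skewCells la mu) (xFin n) (yFin n) ∧
      skewSchurFin a la mu n N = aSum a (skewCells la mu) (xFin n) (yFin n)) := by
  refine ⟨fun mu N hN => ?_, fun la mu hle n N hN =>
    ⟨skewSchurFin_eq_diagonalSum a hle n hN, skewSchurFin_eq_aSum a hle n hN⟩⟩
  have hconn : ((mu.cells : Finset (ℕ × ℕ)) : Set (ℕ × ℕ)).OrdConnected := by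
    rw [← skewCells_bot]
    exact ordConnected_skewCells mu ⊥
  refine ⟨isFormalSum_diagonalWeight a hN, ?_, fun n => ⟨superFin_schur_eq_diagonalSum a n hN, ?_⟩⟩
  · have h : (fun T : {T : mu.cells → ℕ // IsDiagonalStrict T} => aSumOver a xInf yInf T.1) =
        fun T => diagonalWeight a xInf yInf T.1 :=
      funext fun T => aSumOver_eq_diagonalWeight a xInf yInf hconn T.2
    rw [h]
    exact isFormalSum_diagonalWeight a hN
  · rw [superFin_schur_eq_diagonalSum a n hN, aSum_eq_diagonalSum a hconn]
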